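/- **Setting.** Let $k,d\ge 1$, $\mathcal Z=[0,1]^k$, and let $\mathbf z_1,\mathbf z_2,\dots$ be a stationary process with values in $\mathcal Z$; write $\mathbf z_i^j=(\mathbf z_i,\dots,\mathbf z_j)$. Its $\beta$-mixing coefficients are $$\beta(j)=\sup_{t\ge 1}\ \mathbb E\Big[\sup_{A\in\sigma(\mathbf z_{t+j}^\infty)}\big|\mathbb P(A\mid \mathbf z_1^t)-\mathbb P(A)\big|\Big];$$ the process is $\beta$-mixing if $\beta(j)\to0$, and exponentially $\beta$-mixing if $\beta(j)\le c_1e^{-c_2j}$ for some $c_1,c_2>0$. Let $\mathcal H$ be a hypothesis set and $\ell:\mathcal H\times\mathcal Z\to[0,1]$ a loss, such that $\{\ell(h,\cdot):h\in\mathcal H\}$ satisfies the usual measurability condition: all functions $\ell(h,\cdot)$ are measurable, and for all $m$ and $w\in\mathbb R^m$ the function $(y_1,\dots,y_m)\mapsto\sup_h|\sum_i w_i\ell(h,y_i)|$ is universally measurable on $\mathcal Z^m$. The conditional risk is $$R(h,\bar z)=\mathbb E\big[\ell(h,\mathbf z_{N+1})\mid \mathbf z_{N-d+1}^N=\bar z\big],\qquad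 \bar z\in\mathcal Z^d .$$ Let $K:\mathbb R^{kd}\to[0,\infty)$ be a smoothing kernel: $\int K=1$, $K$ is bounded by $K_1$, $\int u_iK(u)\,du=0$ and $\int u_iu_jK(u)\,du\le K_2$ for all $i,j$ (these integrals being absolutely convergent), and $|K(u)-K(v)|\le L\|u-v\|^\gamma$ for some $\gamma>0$. For a bandwidth $b>0$ put $$\hat R(h,\bar z)=\frac{\sum_{i=d}^{N-1}\ell(h,\mathbf z_{i+1})\,K\big((\bar z-\mathbf z_{i-d+1}^i)/b\big)}{\sum_{i=d}^{N-1}K\big((\bar z-\mathbf z_{i-d+1}^i)/b\big)}\qquad(0/0:=0).$$ For $\theta>0$ let $\mathcal N_1(\theta,n)$ be the maximal covering number of the loss class $\{\ell(h,\cdot):h\in\mathcal H\}$: the supremum over samples $x_1,\dots,x_n\in\mathcal Z$ of the least cardinality of a set $V$ of real functions on $\mathcal Z$ such that every $h\in\mathcal H$ has a $v\in V$ with $\frac1n\sum_{i=1}^n|\ell(h,x_i)-v(x_i)|\le\theta$. **Theorem.** Fix $k$, $d$, a smoothing kernel $K$, a function $C(\theta,n)$ with natural-number values such that $\frac1n\log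 C(\theta,n)\to0$ as $n\to\infty$ for every $\theta>0$, and a sequence $\bar\beta(j)\to0$. There is a sequence $b_0(N)>0$ with $b_0(N)\to0$, depending only on these data, such that the following holds for every stationary process and every loss class as above with $\beta(j)\le\bar\beta(j)$ for all $j$ and $\mathcal N_1(\theta,n)\le C(\theta,n)$ for all $\theta>0$ and all $n$. Assume that * there are $D_0,D_1>0$ with $D_0\lambda(B)\le\mathbb P(\mathbf z_{i-d+1}^i\in B)\le D_1\lambda(B)$ for all Borel $B\subseteq\mathcal Z^d$ and $i\ge d$, where $\lambda$ is Lebesgue measure on $\mathbb R^{kd}$; * (a version of) $R(h,\cdot)$ is $L_R$-Lipschitz on $\mathcal Z^d$ for every $h\in\mathcal H$, with $L_R$ not depending on $h$. Then for every sequence of bandwidths $b=b_N>0$ with $b_N\to0$ and $b_N\ge b_0(N)$ for all large $N$, $$\sup_{h\in\mathcal H}\big|R(h,\mathbf z_{N-d+1}^N)-\hat R(h,\mathbf z_{N-d+1}^N)\big|\longrightarrow0\quad\text{in probability as }N\to\infty .$$ If moreover the process is exponentially $\beta$-mixing and $K$ is not identically zero on any of the $2^{kd}$ open orthants of $\mathbb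 R^{kd}$ (for example if $K(0)>0$), then the convergence holds almost surely. -/

import Mathlib

open MeasureTheory ProbabilityTheory Filter Topology
open scoped ENNReal

noncomputable section

namespace CondRisk

/-- The sample space `𝒵 = [0,1]^k`. -/
abbrev Cube (k : ℕ) : Type := Fin k → unitInterval

/-- The Euclidean space `ℝ^{kd}`; the coordinate `(j, l)` is the `l`-th coordinate of the `j`-th
point of a history. -/
abbrev HistSpace (d k : ℕ) : Type := EuclideanSpace ℝ (Fin d × Fin k)

/-- A history in `𝒵^d`, seen as a vector of `ℝ^{kd}`. -/
def toVec {d k : ℕ} (x : Fin d → Cube k) : HistSpace d k :=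
  WithLp.toLp 2 fun p => (x p.1 p.2 : ℝ)

/-- `K` is a smoothing kernel on `ℝ^{kd}`: nonnegative, of integral one, bounded by `K₁`, with
vanishing first moments and second moments at most `K₂`, and Lipschitz of order `γ`. -/
structure IsSmoothingKernel {d k : ℕ} (K : HistSpace d k → ℝ) (K₁ K₂ L γ : ℝ) : Prop where
  nonneg : ∀ x, 0 ≤ K x
  integrable : Integrable K
  integral_eq_one : ∫ x, K x = 1
  le_bound : ∀ x, K x ≤ K₁
  integrable_first : ∀ p, Integrable fun x : HistSpace d k => x p * K x
  first_moment : ∀ p, ∫ x : HistSpace d k, x p * K x = 0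
  integrable_second : ∀ p q, Integrable fun x : HistSpace d k => x p * x q * K x
  second_moment : ∀ p q, ∫ x : HistSpace d k, x p * x q * K x ≤ K₂
  order_pos : 0 < γ
  holder : ∀ x y, |K x - K y| ≤ L * ‖x - y‖ ^ γ

/-- The kernel charges every open orthant of `ℝ^{kd}`. For instance, a continuous kernel with
`0 < K 0` does. -/
def ChargesOrthants {d k : ℕ} (K : HistSpace d k → ℝ) : Prop :=
  ∀ A : Set (Fin d × Fin k), ∃ x : HistSpace d k,
    (∀ p ∈ A, 0 < x p) ∧ (∀ p ∉ A, x p < 0) ∧ 0 < K x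

section Sequences

variable {Ω : Type*} {k : ℕ}

/-- The history of length `d` that precedes time `i` (for `d ≤ i`). The sequence is indexed from
`0`: `z i` is the `(i+1)`-st point, so `hist z d i` consists of the points number
`i-d+1, …, i`, and the point that follows it is `z i`. -/
def hist (z : ℕ → Ω → Cube k) (d i : ℕ) (ω : Ω) : Fin d → Cube k :=
  fun j => z (i - d + j) ω

variable [MeasurableSpace Ω]

/-- Stationarity: the first `m` points are distributed as any `m` consecutive points. -/
def IsStationary (μ : Measure Ω) (z : ℕ → Ω → Cube k) : Prop :=
  ∀ m s : ℕ, μ.map (fun ω (i : Fin m) => z i ω) = μ.map (fun ω (i : Fin m) => z (s + i) ω)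

/-- The first `t` points. -/
def past (z : ℕ → Ω → Cube k) (t : ℕ) (ω : Ω) : Fin t → Cube k := fun i => z i ω

/-- All points `z s, z (s+1), …`. -/
def future (z : ℕ → Ω → Cube k) (s : ℕ) (ω : Ω) : ℕ → Cube k := fun i => z (s + i) ω

/-- The `j`-th `β`-mixing coefficient
`sup_t E [ sup_A |P(A | z_1^t) - P(A)| ]`, `A` running over the events generated by `z_{t+j}^∞`,
computed with the regular conditional distribution. The index `t` below stands for the
number of past points minus one. -/
def betaCoeff (μ : Measure Ω) [IsFiniteMeasure μ] (z : ℕ → Ω → Cube k) (j : ℕ) : ℝ≥0∞ :=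
  ⨆ t : ℕ, ∫⁻ ω, ⨆ (C : Set (ℕ → Cube k)) (_ : MeasurableSet C),
    ENNReal.ofReal |(condDistrib (future z (t + j)) (past z (t + 1)) μ (past z (t + 1) ω)).real C
      - μ.real (future z (t + j) ⁻¹' C)| ∂μ

/-- Exponential `β`-mixing. -/
def IsExpBetaMixing (μ : Measure Ω) [IsFiniteMeasure μ] (z : ℕ → Ω → Cube k) : Prop :=
  ∃ c₁ c₂ : ℝ, 0 < c₁ ∧ 0 < c₂ ∧
    ∀ j : ℕ, betaCoeff μ z j ≤ ENNReal.ofReal (c₁ * Real.exp (-c₂ * j))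

/-- On the Borel sets of `[0,1]^{kd}` the law of every history lies between
`D₀` and `D₁` times Lebesgue measure. -/
def HistComparable (μ : Measure Ω) (z : ℕ → Ω → Cube k) (d : ℕ) (D₀ D₁ : ℝ) : Prop :=
  ∀ i, d ≤ i → ∀ B : Set (HistSpace d k), MeasurableSet B →
    (∀ x ∈ B, ∀ p, x p ∈ Set.Icc (0 : ℝ) 1) →
      ENNReal.ofReal D₀ * volume B ≤ μ {ω | toVec (hist z d i ω) ∈ B} ∧
        μ {ω | toVec (hist z d i ω) ∈ B} ≤ ENNReal.ofReal D₁ * volume B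

/-- `R` is (a version of) the conditional risk
`R(h, x) = E [ ℓ(h, z_{N+1}) | z_{N-d+1}^N = x ]`. -/
def IsConditionalRisk {H : Type*} (μ : Measure Ω) (z : ℕ → Ω → Cube k) (d : ℕ)
    (ℓ : H → Cube k → ℝ) (R : H → (Fin d → Cube k) → ℝ) : Prop :=
  ∀ h, ∀ N, d ≤ N →
    μ[fun ω => ℓ h (z N ω) | MeasurableSpace.comap (hist z d N) inferInstance]
      =ᵐ[μ] fun ω => R h (hist z d N ω)

end Sequences

section Estimator

variable {Ω H : Type*} {d k : ℕ}

/-- The denominator of the estimator, from the first `N` points with bandwidth `b`. -/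
def denomEst (K : HistSpace d k → ℝ) (z : ℕ → Ω → Cube k) (b : ℝ) (N : ℕ)
    (x : Fin d → Cube k) (ω : Ω) : ℝ :=
  1 / (((Finset.Ico d N).card : ℝ) * b ^ d) *
    ∑ i ∈ Finset.Ico d N, K (b⁻¹ • (toVec x - toVec (hist z d i ω)))

/-- The numerator of the estimator. -/
def numerEst (K : HistSpace d k → ℝ) (ℓ : H → Cube k → ℝ) (z : ℕ → Ω → Cube k) (b : ℝ) (N : ℕ)
    (h : H) (x : Fin d → Cube k) (ω : Ω) : ℝ :=
  1 / (((Finset.Ico d N).card : ℝ) * b ^ d) *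
    ∑ i ∈ Finset.Ico d N, ℓ h (z i ω) * K (b⁻¹ • (toVec x - toVec (hist z d i ω)))

/-- The empirical conditional risk estimator (with `0 / 0 = 0`). -/
def riskEst (K : HistSpace d k → ℝ) (ℓ : H → Cube k → ℝ) (z : ℕ → Ω → Cube k) (b : ℝ) (N : ℕ)
    (h : H) (x : Fin d → Cube k) (ω : Ω) : ℝ :=
  numerEst K ℓ z b N h x ω / denomEst K z b N x ω

/-- The uniform deviation `sup_h |R(h, z_{N-d+1}^N) - R̂(h, z_{N-d+1}^N)|`. -/
def uniformDeviation (K : HistSpace d k → ℝ) (ℓ : H → Cube k → ℝ) (R : H → (Fin d → Cube k) → ℝ)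
    (z : ℕ → Ω → Cube k) (b : ℝ) (N : ℕ) (ω : Ω) : ℝ≥0∞ :=
  ⨆ h : H, ENNReal.ofReal |R h (hist z d N ω) - riskEst K ℓ z b N h (hist z d N ω) ω|

end Estimator

section Covering

variable {X : Type*}

/-- `V` is a `θ`-cover of `F` in the empirical `ℓ₁`-norm on the sample `x`. -/
def IsCover (θ : ℝ) (F : Set (X → ℝ)) {n : ℕ} (x : Fin n → X) (V : Finset (X → ℝ)) : Prop :=
  ∀ f ∈ F, ∃ v ∈ V, 1 / (n : ℝ) * ∑ i, |f (x i) - v (x i)| ≤ θ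

/-- The `θ`-covering number of `F` on a sample (`⊤` if there is no finite cover). -/
def coveringNumber (θ : ℝ) (F : Set (X → ℝ)) {n : ℕ} (x : Fin n → X) : ℕ∞ :=
  ⨅ (V : Finset (X → ℝ)) (_ : IsCover θ F x V), (V.card : ℕ∞)

/-- The maximal `θ`-covering number `𝒩₁(θ, F, n)`. -/
def maxCoveringNumber (θ : ℝ) (F : Set (X → ℝ)) (n : ℕ) : ℕ∞ :=
  ⨆ x : Fin n → X, coveringNumber θ F x

end Covering

/-- The usual measurability condition on a loss class: suprema of absolute values of finite linear
combinations are universally measurable. -/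
def IsMeasurableClass {k : ℕ} {H : Type*} (ℓ : H → Cube k → ℝ) : Prop :=
  ∀ (m : ℕ) (w : Fin m → ℝ) (ν : Measure (Fin m → Cube k)), IsFiniteMeasure ν →
    AEMeasurable (fun x : Fin m → Cube k => ⨆ h, |∑ i, w i * ℓ h (x i)|) ν

end CondRisk

end

/-! The point at which the estimator is evaluated, the last history, depends on the sample.
Numerator and denominator are therefore controlled uniformly over the class and over all points `x`
of `ℝ^{kd}`. The denominator is the numerator for the constant loss `oneLoss`, so one deviation
bound serves both.

For independent samples that bound is classical symmetrisation (`measure_pi_exists_deviation_le`):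
ghost sample, random swaps, finite cover, Hoeffding. For the process, `n` blocks of `d + 1` points
whose starting times are `a` apart are independent up to an error `n β(a - d)`
(`measure_blocks_le`), and the residues modulo `a` sort the starting times into `a` such families. A
union bound over the families would cost a factor `a` and hence require a rate for `β`. Instead,
`measure_exists_windowDeviation_le` applies Markov's inequality to the number of bad families: a
proportion below `ε` does little harm to the sum. The cost is `1 / ε`, whatever `a` is, so `β → 0`
suffices.

To pass to kernel weights uniformly in `x`, `measure_exists_kernelDeviation_le` cuts the histories
into finitely many small cells. By Hölder continuity the kernel is nearly constant on each cell, so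
a kernel sum is nearly a combination of sums restricted to cells, and `x` enters only through the
bounded coefficients.

For the bias, conditioning on the history replaces the loss by `R`, and the Lipschitz bound gives an
error of order `b * b^{kd}` (`abs_integral_sub_mul_integral_le`). The mean of the denominator is at
least of order `b^{kd}` wherever a fixed part of the rescaled kernel mass stays in the cube. That
holds for small `b` away from the boundary, and up to the boundary if the kernel charges all
orthants. The ratio is then close to `R` (`abs_sub_riskEst_le`).

The threshold comes from a diagonal argument (`exists_bandwidth`): for fixed accuracy and fixed
minimal bandwidth some number of blocks suffices, uniformly over processes and classes, and both are
then sent to zero slowly. Convergence in probability uses so few blocks that `n² β → 0`, and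
discards a thin boundary layer. Almost sure convergence uses about `√N` blocks and Borel–Cantelli.
-/

noncomputable section

namespace CondRisk

/-! ### Concentration of Rademacher sums. -/

section Rademacher

/-- The sign attached to a Boolean. -/
def boolSign (s : Bool) : ℝ := if s then 1 else -1

lemma sum_exp_boolSign {n : ℕ} (a : Fin n → ℝ) :
    ∑ σ : Fin n → Bool, Real.exp (∑ i, boolSign (σ i) * a i) = ∏ i, (2 * Real.cosh (a i)) := by
  have h : ∀ i, 2 * Real.cosh (a i) = ∑ s : Bool, Real.exp (boolSign s * a i) := by
    intro i
    rw [Fintype.sum_bool, Real.cosh_eq]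
    simp [boolSign]
    ring
  simp_rw [h, Finset.prod_univ_sum, Real.exp_sum, Fintype.piFinset_univ]

/-- Chernoff's method with exponent `t`, the optimal choice, and `cosh y ≤ exp (y² / 2)` for each
factor of the moment generating function. -/
lemma card_lt_sum_boolSign_le {n : ℕ} (a : Fin n → ℝ) (ha : ∀ i, |a i| ≤ 1) {t : ℝ} (ht : 0 ≤ t) :
    (Finset.card {σ : Fin n → Bool | n * t < ∑ i, boolSign (σ i) * a i} : ℝ)
      ≤ 2 ^ n * Real.exp (-(n * t ^ 2 / 2)) := by
  have h1 : ∑ σ : Fin n → Bool, Real.exp (∑ i, boolSign (σ i) * (t * a i))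
      ≤ 2 ^ n * Real.exp (n * t ^ 2 / 2) := by
    rw [sum_exp_boolSign]
    calc ∏ i, (2 * Real.cosh (t * a i)) ≤ ∏ _i : Fin n, (2 * Real.exp (t ^ 2 / 2)) := by
          refine Finset.prod_le_prod (fun i _ => by positivity) fun i _ => ?_
          gcongr
          refine (Real.cosh_le_exp_half_sq _).trans (Real.exp_le_exp.2 ?_)
          have := sq_le_one_iff_abs_le_one (a i) |>.2 (ha i)
          rw [mul_pow]
          nlinarith [sq_nonneg t]
      _ = 2 ^ n * Real.exp (n * t ^ 2 / 2) := by
          rw [Finset.prod_const, Finset.card_univ, Fintype.card_fin, mul_pow, ← Real.exp_nat_mul]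
          ring_nf
  have h2 : (Finset.card {σ : Fin n → Bool | n * t < ∑ i, boolSign (σ i) * a i} : ℝ)
      * Real.exp (n * t ^ 2) ≤ 2 ^ n * Real.exp (n * t ^ 2 / 2) := by
    refine le_trans ?_ h1
    rw [← nsmul_eq_mul]
    refine (Finset.card_nsmul_le_sum _ (fun σ : Fin n → Bool =>
      Real.exp (∑ i, boolSign (σ i) * (t * a i))) _ fun σ hσ => ?_).trans
      (Finset.sum_le_sum_of_subset_of_nonneg (Finset.subset_univ _) fun _ _ _ => by positivity)
    have hσ := (Finset.mem_filter.1 hσ).2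
    refine Real.exp_le_exp.2 ?_
    have : ∑ i, boolSign (σ i) * (t * a i) = t * ∑ i, boolSign (σ i) * a i := by
      rw [Finset.mul_sum]; exact Finset.sum_congr rfl fun i _ => by ring
    rw [this]
    nlinarith
  have h3 : Real.exp (-(n * t ^ 2 / 2)) = Real.exp (n * t ^ 2 / 2) / Real.exp (n * t ^ 2) := by
    rw [← Real.exp_sub]; ring_nf
  rw [h3, ← mul_div_assoc, le_div_iff₀ (Real.exp_pos _)]
  exact h2

/-- Hoeffding's inequality for Rademacher sums, in counting form. -/
lemma card_lt_abs_sum_boolSign_le {n : ℕ} (a : Fin n → ℝ) (ha : ∀ i, |a i| ≤ 1) {t : ℝ}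
    (ht : 0 ≤ t) :
    (Finset.card {σ : Fin n → Bool | n * t < |∑ i, boolSign (σ i) * a i|} : ℝ)
      ≤ 2 ^ n * (2 * Real.exp (-(n * t ^ 2 / 2))) := by
  have h1 := card_lt_sum_boolSign_le a ha ht
  have h2 := card_lt_sum_boolSign_le (fun i => -a i) (fun i => by simpa using ha i) ht
  have h3 : (Finset.univ.filter fun σ : Fin n → Bool => n * t < |∑ i, boolSign (σ i) * a i|) ⊆
      (Finset.univ.filter fun σ : Fin n → Bool => n * t < ∑ i, boolSign (σ i) * a i) ∪
      (Finset.univ.filter fun σ : Fin n → Bool => n * t < ∑ i, boolSign (σ i) * -a i) := by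
    intro σ hσ
    simpa [lt_abs] using hσ
  have h4 := (Finset.card_le_card h3).trans (Finset.card_union_le _ _)
  have h5 : (Finset.card {σ : Fin n → Bool | n * t < |∑ i, boolSign (σ i) * a i|} : ℝ)
    ≤ (Finset.card {σ : Fin n → Bool | n * t < ∑ i, boolSign (σ i) * a i} : ℝ)
      + (Finset.card {σ : Fin n → Bool | n * t < ∑ i, boolSign (σ i) * -a i} : ℝ) := by
    exact_mod_cast h4
  linarith

end Rademacher

/-! ### Finite covers and the union bound over sign patterns. -/

section Covering

variable {X : Type*}

lemma exists_isCover_of_coveringNumber_le {θ : ℝ} {F : Set (X → ℝ)} {n M : ℕ} {x : Fin n → X}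
    (h : coveringNumber θ F x ≤ M) : ∃ V : Finset (X → ℝ), IsCover θ F x V ∧ V.card ≤ M := by
  have h' : coveringNumber θ F x < (M + 1 : ℕ) := lt_of_le_of_lt h (by exact_mod_cast Nat.lt_succ_self M)
  simp only [coveringNumber, iInf_lt_iff] at h'
  obtain ⟨V, hV, hc⟩ := h'
  exact ⟨V, hV, by have : V.card < M + 1 := by exact_mod_cast hc
                   omega⟩

lemma coveringNumber_le_of_isCover {θ : ℝ} {F : Set (X → ℝ)} {n M : ℕ} {x : Fin n → X}
    {V : Finset (X → ℝ)} (hV : IsCover θ F x V) (hc : V.card ≤ M) : coveringNumber θ F x ≤ M :=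
  (iInf₂_le V hV).trans (by exact_mod_cast hc)

/-- Sign patterns for which some symmetrised sum of the class is large are rare. -/
lemma card_exists_lt_abs_sum_boolSign_le {H : Type*} {F : H → X → ℝ}
    (hF : ∀ h y, F h y ∈ Set.Icc (0 : ℝ) 1) {n M : ℕ} {ε : ℝ} (hε : 0 < ε) (x x' : Fin n → X)
    (hcov : coveringNumber (ε / 8) (Set.range F) (Fin.append x x') ≤ M) :
    (Set.ncard {σ : Fin n → Bool |
        ∃ h, n * (ε / 2) < |∑ i, boolSign (σ i) * (F h (x i) - F h (x' i))|} : ℝ)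
      ≤ 2 ^ n * (2 * M * Real.exp (-(n * ε ^ 2 / 32))) := by
  classical
  obtain ⟨V, hV, hc⟩ := exists_isCover_of_coveringNumber_le hcov
  -- Cover functions need not be bounded. Clipping them to `[0, 1]` brings them no further from the
  -- class and makes Hoeffding's inequality applicable to their differences.
  let c : ℝ → ℝ := fun y => max 0 (min 1 y)
  have hc01 : ∀ y, 0 ≤ c y ∧ c y ≤ 1 := fun y => ⟨le_max_left _ _, by simp [c]⟩
  have hcl : ∀ u ∈ Set.Icc (0 : ℝ) 1, ∀ y, |u - c y| ≤ |u - y| := by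
    intro u hu y
    simp only [c]
    rcases le_total y 0 with h0 | h0
    · rw [min_eq_right (h0.trans zero_le_one), max_eq_left h0, sub_zero, abs_of_nonneg hu.1,
        abs_of_nonneg (by linarith [hu.1])]
      linarith
    · rcases le_total y 1 with h1 | h1
      · rw [min_eq_right h1, max_eq_right h0]
      · rw [min_eq_left h1, max_eq_right zero_le_one, abs_sub_comm, abs_sub_comm u,
          abs_of_nonneg (by linarith [hu.2]), abs_of_nonneg (by linarith [hu.2])]
        linarith
  let A : (X → ℝ) → Finset (Fin n → Bool) := fun v =>
    {σ | n * (ε / 4) < |∑ i, boolSign (σ i) * (c (v (x i)) - c (v (x' i)))|}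
  have hsub : {σ : Fin n → Bool |
        ∃ h, n * (ε / 2) < |∑ i, boolSign (σ i) * (F h (x i) - F h (x' i))|} ⊆
      ((V.biUnion A : Finset (Fin n → Bool)) : Set (Fin n → Bool)) := by
    rintro σ ⟨h, hh⟩
    obtain ⟨v, hvV, hv⟩ := hV (F h) ⟨h, rfl⟩
    have hn : 0 < n := by
      rcases Nat.eq_zero_or_pos n with rfl | hn
      · simp at hh
      · exact hn
    have hn' : (0 : ℝ) < n := by exact_mod_cast hn
    -- A mean error `ε / 8` over the `2n` points of the joint sample is a total error `n ε / 4`,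
    -- half of the margin `n ε / 2`.
    have hv' : ∑ i, |F h (x i) - v (x i)| + ∑ i, |F h (x' i) - v (x' i)| ≤ n * (ε / 4) := by
      rw [Fin.sum_univ_add] at hv
      simp only [Fin.append_left, Fin.append_right] at hv
      rw [one_div, inv_mul_le_iff₀ (by push_cast; positivity)] at hv
      push_cast at hv
      linarith
    have hd : |∑ i, boolSign (σ i) * (F h (x i) - F h (x' i))
        - ∑ i, boolSign (σ i) * (c (v (x i)) - c (v (x' i)))| ≤ n * (ε / 4) := by
      refine le_trans ?_ hv'
      rw [← Finset.sum_sub_distrib, ← Finset.sum_add_distrib]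
      refine (Finset.abs_sum_le_sum_abs _ _).trans (Finset.sum_le_sum fun i _ => ?_)
      have hs : |boolSign (σ i)| = 1 := by unfold boolSign; split_ifs <;> simp
      rw [← mul_sub, abs_mul, hs, one_mul]
      have e : F h (x i) - F h (x' i) - (c (v (x i)) - c (v (x' i)))
        = (F h (x i) - c (v (x i))) - (F h (x' i) - c (v (x' i))) := by ring
      rw [e]
      exact (abs_sub _ _).trans (add_le_add (hcl _ (hF _ _) _) (hcl _ (hF _ _) _))
    simp only [Finset.coe_biUnion, Set.mem_iUnion, A]
    refine ⟨v, hvV, ?_⟩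
    simp only [Finset.coe_filter, Finset.mem_univ, true_and, Set.mem_ofPred_eq]
    have := abs_sub_abs_le_abs_sub (∑ i, boolSign (σ i) * (F h (x i) - F h (x' i)))
      (∑ i, boolSign (σ i) * (c (v (x i)) - c (v (x' i))))
    linarith
  have h1 : (Set.ncard {σ : Fin n → Bool |
        ∃ h, n * (ε / 2) < |∑ i, boolSign (σ i) * (F h (x i) - F h (x' i))|}) ≤
      ∑ v ∈ V, (A v).card := by
    refine (Set.ncard_le_ncard hsub (Set.toFinite _)).trans ?_
    rw [Set.ncard_coe_finset]
    exact Finset.card_biUnion_le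
  have h2 : ∀ v ∈ V, ((A v).card : ℝ) ≤ 2 ^ n * (2 * Real.exp (-(n * (ε / 4) ^ 2 / 2))) :=
    fun v _ => card_lt_abs_sum_boolSign_le _ (fun i => by
      rw [abs_le]; constructor <;> linarith [hc01 (v (x i)), hc01 (v (x' i))]) (by positivity)
  calc _ ≤ ((∑ v ∈ V, (A v).card : ℕ) : ℝ) := by exact_mod_cast h1
    _ = ∑ v ∈ V, ((A v).card : ℝ) := by push_cast; rfl
    _ ≤ V.card • (2 ^ n * (2 * Real.exp (-(n * (ε / 4) ^ 2 / 2)))) :=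
        Finset.sum_le_card_nsmul _ _ _ h2
    _ = 2 ^ n * (2 * V.card * Real.exp (-(n * ε ^ 2 / 32))) := by
        rw [nsmul_eq_mul]; ring_nf
    _ ≤ _ := by gcongr

end Covering

/-! ### Symmetrisation for independent samples. -/

section Symmetrization

variable {S : Type*} [MeasurableSpace S]

/-- Exchanging the coordinates in a pair of samples according to a sign pattern. -/
def swapSamples {n : ℕ} (σ : Fin n → Bool) (p : (Fin n → S) × (Fin n → S)) :
    (Fin n → S) × (Fin n → S) :=
  (fun i => if σ i then p.1 i else p.2 i, fun i => if σ i then p.2 i else p.1 i)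

/-- A pair of samples is a sample of pairs; the swap then acts coordinate by coordinate, and `ν.prod
ν` is symmetric. -/
lemma measurePreserving_swapSamples (ν : Measure S) [IsProbabilityMeasure ν] {n : ℕ}
    (σ : Fin n → Bool) :
    MeasurePreserving (swapSamples (S := S) σ)
      ((Measure.pi fun _ => ν).prod (Measure.pi fun _ => ν))
      ((Measure.pi fun _ => ν).prod (Measure.pi fun _ => ν)) := by
  have h := measurePreserving_arrowProdEquivProdArrow S S (Fin n) (fun _ => ν) (fun _ => ν)
  have hs := measurePreserving_pi (fun _ : Fin n => ν.prod ν) (fun _ : Fin n => ν.prod ν)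
    (f := fun i p => if σ i then p else p.swap) (fun i => by
      by_cases hi : σ i
      · simp only [hi, if_true]; exact MeasurePreserving.id _
      · simpa [hi] using Measure.measurePreserving_swap)
  have := h.comp (hs.comp h.symm)
  convert! this using 1
  funext p
  simp only [swapSamples, Function.comp_apply, MeasurableEquiv.arrowProdEquivProdArrow,
    MeasurableEquiv.coe_mk, MeasurableEquiv.symm_mk, Equiv.arrowProdEquivProdArrow,
    Equiv.coe_fn_mk, Equiv.coe_fn_symm_mk]
  ext i
  · by_cases hi : σ i <;> simp [hi]
  · by_cases hi : σ i <;> simp [hi]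

variable {H : Type*}

/-- Every swap preserves the joint law, so the probability equals its average over all sign
patterns. For a fixed pair of samples, the bad patterns are counted by
`card_exists_lt_abs_sum_boolSign_le`. -/
lemma measure_symmetrised_le (ν : Measure S) [IsProbabilityMeasure ν] {F : H → S → ℝ}
    (hF : ∀ h y, F h y ∈ Set.Icc (0 : ℝ) 1) {n M : ℕ} {ε : ℝ} (hε : 0 < ε)
    (hcov : ∀ x : Fin (n + n) → S, coveringNumber (ε / 8) (Set.range F) x ≤ M)
    (hmeas : NullMeasurableSet {p : (Fin n → S) × (Fin n → S) |
        ∃ h, n * (ε / 2) < |∑ i, (F h (p.1 i) - F h (p.2 i))|}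
      ((Measure.pi fun _ => ν).prod (Measure.pi fun _ => ν))) :
    ((Measure.pi fun _ => ν).prod (Measure.pi fun _ => ν)) {p : (Fin n → S) × (Fin n → S) |
        ∃ h, n * (ε / 2) < |∑ i, (F h (p.1 i) - F h (p.2 i))|}
      ≤ ENNReal.ofReal (2 * M * Real.exp (-(n * ε ^ 2 / 32))) := by
  classical
  set P := (Measure.pi fun _ : Fin n => ν).prod (Measure.pi fun _ : Fin n => ν) with hP
  set T := {p : (Fin n → S) × (Fin n → S) |
        ∃ h, n * (ε / 2) < |∑ i, (F h (p.1 i) - F h (p.2 i))|} with hT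
  have hpre : ∀ σ : Fin n → Bool, P (swapSamples σ ⁻¹' T) = P T := fun σ =>
    (measurePreserving_swapSamples ν σ).measure_preimage hmeas
  have hnm : ∀ σ : Fin n → Bool, NullMeasurableSet (swapSamples σ ⁻¹' T) P := fun σ =>
    hmeas.preimage (measurePreserving_swapSamples ν σ).quasiMeasurePreserving
  have hmem : ∀ σ : Fin n → Bool, ∀ p, p ∈ swapSamples σ ⁻¹' T ↔
      ∃ h, n * (ε / 2) < |∑ i, boolSign (σ i) * (F h (p.1 i) - F h (p.2 i))| := by
    intro σ p
    simp only [hT, Set.mem_preimage, Set.mem_ofPred_eq, swapSamples]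
    refine exists_congr fun h => ?_
    have : ∀ i, F h (if σ i then p.1 i else p.2 i) - F h (if σ i then p.2 i else p.1 i)
        = boolSign (σ i) * (F h (p.1 i) - F h (p.2 i)) := by
      intro i
      by_cases hi : σ i <;> simp [hi, boolSign]
    simp_rw [this]
  have key : (2 : ℝ≥0∞) ^ n * P T ≤
      2 ^ n * ENNReal.ofReal (2 * M * Real.exp (-(n * ε ^ 2 / 32))) := by
    calc (2 : ℝ≥0∞) ^ n * P T = ∑ σ : Fin n → Bool, P (swapSamples σ ⁻¹' T) := by
          simp [hpre]
      _ = ∑ σ : Fin n → Bool, ∫⁻ p, (swapSamples σ ⁻¹' T).indicator 1 p ∂P := by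
          refine Finset.sum_congr rfl fun σ _ => ?_
          rw [lintegral_indicator_one₀ (hnm σ)]
      _ = ∫⁻ p, ∑ σ : Fin n → Bool, (swapSamples σ ⁻¹' T).indicator 1 p ∂P := by
          rw [lintegral_finsetSum' _ fun σ _ => ?_]
          exact (aemeasurable_indicator_const_iff (1 : ℝ≥0∞)).2 (hnm σ)
      _ ≤ ∫⁻ _, ENNReal.ofReal (2 ^ n * (2 * M * Real.exp (-(n * ε ^ 2 / 32)))) ∂P := by
          refine lintegral_mono fun p => ?_
          have h1 := card_exists_lt_abs_sum_boolSign_le hF hε p.1 p.2 (hcov _)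
          have h2 : ∑ σ : Fin n → Bool, (swapSamples σ ⁻¹' T).indicator (1 : (Fin n → S) × (Fin n → S) → ℝ≥0∞) p
              = ((Set.ncard {σ : Fin n → Bool |
                  ∃ h, n * (ε / 2) < |∑ i, boolSign (σ i) * (F h (p.1 i) - F h (p.2 i))|} : ℕ)
                  : ℝ≥0∞) := by
            simp_rw [Set.indicator_apply, hmem]
            simp only [Pi.one_apply]
            rw [Finset.sum_boole, Set.ncard_eq_toFinset_card']
            simp
          rw [h2, ← ENNReal.ofReal_natCast]
          exact ENNReal.ofReal_le_ofReal h1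
      _ = _ := by
          rw [lintegral_const, measure_univ, mul_one, ENNReal.ofReal_mul (by positivity),
            ENNReal.ofReal_pow (by norm_num), ENNReal.ofReal_ofNat]
  exact (ENNReal.mul_le_mul_iff_right (by positivity) (by finiteness)).1 key

/-- Chebyshev's inequality, the variance of a `[0, 1]`-valued function being at most `1 / 4`. It
shows that a ghost sample is good for one given function with probability at least one half. -/
lemma measure_pi_sum_sub_integral_le (ν : Measure S) [IsProbabilityMeasure ν] {f : S → ℝ}
    (hf : Measurable f) (hf01 : ∀ y, f y ∈ Set.Icc (0 : ℝ) 1) {n : ℕ} {ε : ℝ} (hε : 0 < ε)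
    (hn : 2 ≤ n * ε ^ 2) :
    (Measure.pi fun _ : Fin n => ν) {x | n * (ε / 2) ≤ |∑ i, (f (x i) - ∫ y, f y ∂ν)|}
      ≤ ENNReal.ofReal (1 / 2) := by
  have hn0 : (0 : ℝ) < n := by
    rcases Nat.eq_zero_or_pos n with rfl | h
    · norm_num at hn
    · exact_mod_cast h
  have hmem : MemLp f 2 ν := MemLp.of_bound hf.aestronglyMeasurable 1 (ae_of_all _ fun y => by
    rw [Real.norm_eq_abs, abs_of_nonneg (hf01 y).1]; exact (hf01 y).2)
  have hint : Integrable f ν := hmem.integrable (by norm_num)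
  have hmp : ∀ i : Fin n, MeasurePreserving (Function.eval i) (Measure.pi fun _ : Fin n => ν) ν :=
    fun i => measurePreserving_eval (fun _ : Fin n => ν) i
  have hmem' : ∀ i : Fin n, MemLp (fun x : Fin n → S => f (x i)) 2 (Measure.pi fun _ => ν) :=
    fun i => hmem.comp_measurePreserving (hmp i)
  have hsum : MemLp (fun x : Fin n → S => ∑ i, f (x i)) 2 (Measure.pi fun _ => ν) :=
    memLp_finsetSum _ fun i _ => hmem' i
  have hmean : ∫ x : Fin n → S, ∑ i, f (x i) ∂(Measure.pi fun _ => ν) = n * ∫ y, f y ∂ν := by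
    rw [integral_finsetSum _ fun i _ => (hmem' i).integrable (by norm_num)]
    have : ∀ i : Fin n, ∫ x : Fin n → S, f (x i) ∂(Measure.pi fun _ => ν) = ∫ y, f y ∂ν := by
      intro i
      have h := integral_map (hmp i).aemeasurable (f := f)
        (by rw [(hmp i).map_eq]; exact hf.aestronglyMeasurable)
      rw [(hmp i).map_eq] at h
      exact h.symm
    simp [this]
  have hvar : variance (fun x : Fin n → S => ∑ i, f (x i)) (Measure.pi fun _ => ν) ≤ n * (1 / 4) := by
    have h1 := variance_sum_pi (μ := fun _ : Fin n => ν) (X := fun _ => f) fun _ => hmem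
    have e : (∑ i : Fin n, fun ω : Fin n → S => f (ω i)) = fun x => ∑ i, f (x i) := by
      ext x; simp
    rw [e] at h1
    rw [h1]
    have h2 := variance_le_sq_of_bounded (μ := ν) (ae_of_all _ hf01) hf.aemeasurable
    simp only [Finset.sum_const, Finset.card_univ, Fintype.card_fin, nsmul_eq_mul]
    gcongr
    linarith
  have := meas_ge_le_variance_div_sq hsum (c := n * (ε / 2)) (by positivity)
  rw [hmean] at this
  have e : ∀ x : Fin n → S, ∑ i, (f (x i) - ∫ y, f y ∂ν) = ∑ i, f (x i) - n * ∫ y, f y ∂ν := by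
    intro x; simp [Finset.sum_sub_distrib]
  simp_rw [e]
  refine this.trans (ENNReal.ofReal_le_ofReal ?_)
  rw [div_le_div_iff₀ (by positivity) (by norm_num)]
  have : (n : ℝ) * 2 ≤ n * (n * ε ^ 2) := by gcongr
  nlinarith

/-- Uniform deviations of a class from the mean, for independent samples. -/
theorem measure_pi_exists_deviation_le (ν : Measure S) [IsProbabilityMeasure ν] {F : H → S → ℝ}
    (hFm : ∀ h, Measurable (F h))
    (hF : ∀ h y, F h y ∈ Set.Icc (0 : ℝ) 1) {n M : ℕ} {ε : ℝ} (hε : 0 < ε)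
    (hn : 2 ≤ n * ε ^ 2)
    (hcov : ∀ x : Fin (n + n) → S, coveringNumber (ε / 8) (Set.range F) x ≤ M)
    (hmeas : NullMeasurableSet {p : (Fin n → S) × (Fin n → S) |
        ∃ h, n * (ε / 2) < |∑ i, (F h (p.1 i) - F h (p.2 i))|}
      ((Measure.pi fun _ => ν).prod (Measure.pi fun _ => ν))) :
    (Measure.pi fun _ : Fin n => ν) {x | ∃ h, n * ε < |∑ i, (F h (x i) - ∫ y, F h y ∂ν)|}
      ≤ ENNReal.ofReal (4 * M * Real.exp (-(n * ε ^ 2 / 32))) := by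
  have hsym := measure_symmetrised_le ν hF hε hcov hmeas
  set P := (Measure.pi fun _ : Fin n => ν).prod (Measure.pi fun _ : Fin n => ν) with hP
  set T := {p : (Fin n → S) × (Fin n → S) |
        ∃ h, n * (ε / 2) < |∑ i, (F h (p.1 i) - F h (p.2 i))|} with hT
  -- Fubini needs a measurable set; the measurable hull has the same measure.
  set T' := toMeasurable P T with hT'
  have hT'm : MeasurableSet T' := measurableSet_toMeasurable _ _
  -- Once `x` has fixed a deviating `h`, at least half of the ghost samples keep the sum for this
  -- `h` within `n ε / 2` of its mean, which leaves a difference above `n ε / 2`.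
  have hlow : {x : Fin n → S | ∃ h, n * ε < |∑ i, (F h (x i) - ∫ y, F h y ∂ν)|} ⊆
      {x | ENNReal.ofReal (1 / 2) ≤ (Measure.pi fun _ : Fin n => ν) (Prod.mk x ⁻¹' T')} := by
    rintro x ⟨h, hx⟩
    have h1 := measure_pi_sum_sub_integral_le ν (hFm h) (hF h) hε hn
    set B := {x' : Fin n → S | n * (ε / 2) ≤ |∑ i, (F h (x' i) - ∫ y, F h y ∂ν)|} with hB
    have hBm : MeasurableSet B := by
      refine measurableSet_le measurable_const ?_
      have := hFm h
      fun_prop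
    have hsub : Bᶜ ⊆ Prod.mk x ⁻¹' T' := by
      intro x' hx'
      refine subset_toMeasurable P T ⟨h, ?_⟩
      have hx' : |∑ i, (F h (x' i) - ∫ y, F h y ∂ν)| < n * (ε / 2) := not_le.1 hx'
      have e : ∑ i, (F h (x i) - F h (x' i)) = ∑ i, (F h (x i) - ∫ y, F h y ∂ν)
          - ∑ i, (F h (x' i) - ∫ y, F h y ∂ν) := by
        rw [← Finset.sum_sub_distrib]; exact Finset.sum_congr rfl fun i _ => by ring
      have := abs_sub_abs_le_abs_sub (∑ i, (F h (x i) - ∫ y, F h y ∂ν))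
        (∑ i, (F h (x' i) - ∫ y, F h y ∂ν))
      show n * (ε / 2) < |∑ i, (F h (x i) - F h (x' i))|
      rw [e]
      linarith
    refine le_trans ?_ (measure_mono hsub)
    rw [prob_compl_eq_one_sub hBm]
    refine le_trans ?_ (tsub_le_tsub_left h1 1)
    rw [← ENNReal.ofReal_one, ← ENNReal.ofReal_sub _ (by norm_num)]
    norm_num
  have hmk := mul_meas_ge_le_lintegral (μ := Measure.pi fun _ : Fin n => ν)
    (measurable_measure_prodMk_left (ν := Measure.pi fun _ : Fin n => ν) hT'm)
    (ENNReal.ofReal (1 / 2))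
  rw [← Measure.prod_apply hT'm, ← hP, hT', measure_toMeasurable] at hmk
  have h2 : ENNReal.ofReal (1 / 2) *
      (Measure.pi fun _ : Fin n => ν) {x | ∃ h, n * ε < |∑ i, (F h (x i) - ∫ y, F h y ∂ν)|} ≤
      ENNReal.ofReal (2 * M * Real.exp (-(n * ε ^ 2 / 32))) :=
    (mul_le_mul_right (measure_mono hlow) _).trans (hmk.trans hsym)
  have h3 : ENNReal.ofReal (2 * M * Real.exp (-(n * ε ^ 2 / 32))) =
      ENNReal.ofReal (1 / 2) * ENNReal.ofReal (4 * M * Real.exp (-(n * ε ^ 2 / 32))) := by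
    rw [← ENNReal.ofReal_mul (by norm_num)]
    ring_nf
  rw [h3] at h2
  exact (ENNReal.mul_le_mul_iff_right (by simp) (by finiteness)).1 h2

end Symmetrization

/-! ### Coupling of separated blocks with independent ones. -/

section Blocking

variable {Ω : Type*} {k : ℕ} [MeasurableSpace Ω]

/-- The `d + 1` consecutive points from time `u` on. -/
def block (z : ℕ → Ω → Cube k) (d u : ℕ) (ω : Ω) : Fin (d + 1) → Cube k := fun j => z (u + j) ω

lemma measurable_block {z : ℕ → Ω → Cube k} (hz : ∀ i, Measurable (z i)) (d u : ℕ) :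
    Measurable (block z d u) := measurable_pi_lambda _ fun _ => hz _

lemma map_block {μ : Measure Ω} {z : ℕ → Ω → Cube k} (hst : IsStationary μ z) (d u : ℕ) :
    μ.map (block z d u) = μ.map (block z d 0) := by
  have := hst (d + 1) u
  unfold block
  simpa using this.symm

/-- The joint law of functions of the past and of the future is close to a product law. -/
lemma measure_past_future_le (μ : Measure Ω) [IsProbabilityMeasure μ] {z : ℕ → Ω → Cube k}
    (hz : ∀ i, Measurable (z i)) {α β : Type*} [MeasurableSpace α] [MeasurableSpace β] (t j : ℕ)
    {f : (Fin (t + 1) → Cube k) → α} (hf : Measurable f) {g : (ℕ → Cube k) → β}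
    (hg : Measurable g) {A : Set (α × β)} (hA : MeasurableSet A) :
    μ {ω | (f (past z (t + 1) ω), g (future z (t + j) ω)) ∈ A} ≤
      ((μ.map fun ω => f (past z (t + 1) ω)).prod (μ.map fun ω => g (future z (t + j) ω))) A
        + betaCoeff μ z j := by
  have hX : Measurable (past z (t + 1)) := measurable_pi_lambda _ fun _ => hz _
  have hY : Measurable (future z (t + j)) := measurable_pi_lambda _ fun _ => hz _
  set X := past z (t + 1)
  set Y := future z (t + j)
  set κ := condDistrib Y X μ
  set C : (Fin (t + 1) → Cube k) → Set (ℕ → Cube k) := fun x => {y | (f x, g y) ∈ A} with hC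
  have hA' : MeasurableSet {p : (Fin (t + 1) → Cube k) × (ℕ → Cube k) | (f p.1, g p.2) ∈ A} :=
    ((hf.comp measurable_fst).prodMk (hg.comp measurable_snd)) hA
  have hCm : ∀ x, MeasurableSet (C x) := fun x => (measurable_const.prodMk hg) hA
  have h1 : μ {ω | (f (X ω), g (Y ω)) ∈ A} = ∫⁻ ω, κ (X ω) (C (X ω)) ∂μ := by
    have e : μ {ω | (f (X ω), g (Y ω)) ∈ A} = μ.map (fun ω => (X ω, Y ω))
        {p : (Fin (t + 1) → Cube k) × (ℕ → Cube k) | (f p.1, g p.2) ∈ A} := by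
      rw [Measure.map_apply (hX.prodMk hY) hA']; rfl
    rw [e, ← compProd_map_condDistrib hY.aemeasurable, Measure.compProd_apply hA',
      lintegral_map (Kernel.measurable_kernel_prodMk_left hA') hX]
    rfl
  have h2 : ((μ.map fun ω => f (X ω)).prod (μ.map fun ω => g (Y ω))) A
      = ∫⁻ ω, μ (Y ⁻¹' C (X ω)) ∂μ := by
    have : IsProbabilityMeasure (μ.map fun ω => g (Y ω)) :=
      Measure.isProbabilityMeasure_map (hg.comp hY).aemeasurable
    rw [Measure.prod_apply hA, lintegral_map (measurable_measure_prodMk_left hA)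
      (show Measurable fun ω => f (X ω) from hf.comp hX)]
    refine lintegral_congr fun ω => ?_
    rw [Measure.map_apply (show Measurable fun ω => g (Y ω) from hg.comp hY)
      (measurable_prodMk_left hA)]
    rfl
  have hm : Measurable fun ω => μ (Y ⁻¹' C (X ω)) := by
    have : IsProbabilityMeasure (μ.map Y) := Measure.isProbabilityMeasure_map hY.aemeasurable
    have := (measurable_measure_prodMk_left (ν := μ.map Y) hA').comp hX
    convert! this using 1
    funext ω
    simp only [Function.comp_apply]
    rw [Measure.map_apply hY (measurable_prodMk_left hA')]
    rfl
  rw [h1, h2]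
  have h3 : ∀ ω, κ (X ω) (C (X ω)) ≤ μ (Y ⁻¹' C (X ω)) +
      ⨆ (C : Set (ℕ → Cube k)) (_ : MeasurableSet C),
        ENNReal.ofReal |(κ (X ω)).real C - μ.real (Y ⁻¹' C)| := by
    intro ω
    refine le_trans ?_ (add_le_add_right (le_iSup₂ (C (X ω)) (hCm (X ω))) _)
    rw [← ofReal_measureReal (μ := κ (X ω)), ← ofReal_measureReal (μ := μ),
      ← ENNReal.ofReal_add measureReal_nonneg (abs_nonneg _)]
    refine ENNReal.ofReal_le_ofReal ?_
    linarith [le_abs_self ((κ (X ω)).real (C (X ω)) - μ.real (Y ⁻¹' C (X ω)))]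
  refine (lintegral_mono h3).trans ?_
  rw [lintegral_add_left hm]
  refine add_le_add_right ?_ _
  exact le_iSup (fun t => ∫⁻ ω, ⨆ (C : Set (ℕ → Cube k)) (_ : MeasurableSet C),
    ENNReal.ofReal |(condDistrib (future z (t + j)) (past z (t + 1)) μ (past z (t + 1) ω)).real C
      - μ.real (future z (t + j) ⁻¹' C)| ∂μ) t

/-- Blocks that are `a` apart are almost independent. -/
theorem measure_blocks_le (μ : Measure Ω) [IsProbabilityMeasure μ] {z : ℕ → Ω → Cube k}
    (hz : ∀ i, Measurable (z i)) (hst : IsStationary μ z) {d a : ℕ} (had : d ≤ a) (r n : ℕ)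
    (A : Set (Fin n → Fin (d + 1) → Cube k)) :
    μ {ω | (fun s : Fin n => block z d (r + a * s) ω) ∈ A} ≤
      (Measure.pi fun _ : Fin n => μ.map (block z d 0)) A + n * betaCoeff μ z (a - d) := by
  set ν := μ.map (block z d 0) with hν
  have : IsProbabilityMeasure ν :=
    Measure.isProbabilityMeasure_map (measurable_block hz d 0).aemeasurable
  suffices h : ∀ A : Set (Fin n → Fin (d + 1) → Cube k), MeasurableSet A →
      μ {ω | (fun s : Fin n => block z d (r + a * s) ω) ∈ A} ≤
        (Measure.pi fun _ : Fin n => ν) A + n * betaCoeff μ z (a - d) by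
    -- An arbitrary `A` is replaced by its measurable hull for the product law: the left side can
    -- only grow, and the product term is unchanged.
    refine le_trans (measure_mono fun ω hω => subset_toMeasurable (Measure.pi fun _ => ν) A hω) ?_
    refine (h _ (measurableSet_toMeasurable _ _)).trans ?_
    rw [measure_toMeasurable]
  clear A
  induction n with
  | zero =>
    intro A hA
    simp only [Nat.cast_zero, zero_mul, add_zero]
    by_cases hmem : (default : Fin 0 → Fin (d + 1) → Cube k) ∈ A
    · have : A = Set.univ := Set.eq_univ_of_forall fun x => by
        rwa [Subsingleton.elim x default]
      rw [this]; simp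
    · have : {ω | (fun s : Fin 0 => block z d (r + a * s) ω) ∈ A} = ∅ :=
        Set.eq_empty_of_forall_notMem fun ω hω => hmem (by
          rwa [Subsingleton.elim default (fun s : Fin 0 => block z d (r + a * s) ω)])
      rw [this]; simp
  | succ n ih =>
    intro A hA
    have hmp := measurePreserving_piFinSuccAbove
      (fun _ : Fin (n + 1) => ν) (Fin.last n)
    set e := MeasurableEquiv.piFinSuccAbove
      (fun _ : Fin (n + 1) => Fin (d + 1) → Cube k) (Fin.last n) with he
    have hA' : MeasurableSet (e.symm ⁻¹' A) := e.symm.measurable hA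
    have hpi : (Measure.pi fun _ : Fin (n + 1) => ν) A
        = (ν.prod (Measure.pi fun _ : Fin n => ν)) (e.symm ⁻¹' A) := by
      rw [← hmp.measure_preimage hA'.nullMeasurableSet, ← Set.preimage_comp]
      simp
    have hset : {ω | (fun s : Fin (n + 1) => block z d (r + a * s) ω) ∈ A} =
        {ω | (block z d (r + a * n) ω, fun s : Fin n => block z d (r + a * s) ω)
          ∈ e.symm ⁻¹' A} := by
      ext ω
      have : e.symm (block z d (r + a * n) ω, fun s : Fin n => block z d (r + a * s) ω)
          = fun s : Fin (n + 1) => block z d (r + a * s) ω := by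
        rw [MeasurableEquiv.symm_apply_eq]
        simp [he, MeasurableEquiv.piFinSuccAbove, Fin.insertNthEquiv]
        rfl
      simp only [Set.mem_ofPred_eq, Set.mem_preimage]
      rw [this]
    have hB : Measurable fun ω => fun s : Fin n => block z d (r + a * s) ω :=
      measurable_pi_lambda _ fun s => measurable_block hz _ _
    have hbound : μ {ω | (block z d (r + a * n) ω, fun s : Fin n => block z d (r + a * s) ω)
          ∈ e.symm ⁻¹' A} ≤
        (ν.prod (μ.map fun ω => fun s : Fin n => block z d (r + a * s) ω)) (e.symm ⁻¹' A)
          + betaCoeff μ z (a - d) := by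
      -- Without earlier blocks there is no past to compare with, and the product formula is exact.
      rcases Nat.eq_zero_or_pos n with rfl | hn
      · refine le_add_right ?_
        have : IsProbabilityMeasure
            (μ.map fun ω => fun s : Fin 0 => block z d (r + a * s) ω) :=
          Measure.isProbabilityMeasure_map hB.aemeasurable
        have hprod : μ.map (fun ω => (block z d (r + a * (0 : ℕ)) ω,
            fun s : Fin 0 => block z d (r + a * s) ω)) =
            ν.prod (μ.map fun ω => fun s : Fin 0 => block z d (r + a * s) ω) := by
          symm
          refine Measure.prod_eq fun s t hs ht => ?_
          rw [hν, ← map_block hst d (r + a * (0 : ℕ)), Measure.map_apply hB ht,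
            Measure.map_apply (measurable_block hz _ _) hs,
            Measure.map_apply ((measurable_block hz _ _).prodMk hB) (hs.prod ht)]
          by_cases hmem : (default : Fin 0 → Fin (d + 1) → Cube k) ∈ t
          · have : t = Set.univ := Set.eq_univ_of_forall fun x => by
              rwa [Subsingleton.elim x default]
            subst this
            simp only [Set.preimage_univ, measure_univ, mul_one]
            congr 1
            ext ω; simp
          · have : t = ∅ := Set.eq_empty_of_forall_notMem fun x hx => hmem (by
              rwa [Subsingleton.elim default x])
            subst this
            simp
        rw [← hprod, Measure.map_apply ((measurable_block hz _ _).prodMk hB) hA']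
        rfl
      -- The past ends at `t`, the last index of the previous block; a gap of `a - d` then leads
      -- exactly to the start `r + a * n` of the new one.
      · set t := r + a * (n - 1) + d with ht
        have hlt : ∀ (s : Fin n) (j : Fin (d + 1)), r + a * (s : ℕ) + (j : ℕ) < t + 1 := by
          intro s j
          have h1 : a * (s : ℕ) ≤ a * (n - 1) := Nat.mul_le_mul_left a (by omega)
          omega
        have htj : t + (a - d) = r + a * n := by
          obtain ⟨m, rfl⟩ : ∃ m, n = m + 1 := ⟨n - 1, by omega⟩
          simp only [Nat.add_sub_cancel] at ht
          rw [Nat.mul_succ]; omega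
        have hf : Measurable fun (x : Fin (t + 1) → Cube k) (s : Fin n) (j : Fin (d + 1)) =>
            x ⟨r + a * s + j, hlt s j⟩ :=
          measurable_pi_lambda _ fun s => measurable_pi_lambda _ fun j => measurable_pi_apply _
        have hg : Measurable fun (y : ℕ → Cube k) (j : Fin (d + 1)) => y j :=
          measurable_pi_lambda _ fun j => measurable_pi_apply _
        have := measure_past_future_le μ hz t (a - d) hf hg (measurable_swap hA')
        have e1 : (fun ω => (fun (y : ℕ → Cube k) (j : Fin (d + 1)) => y j)
            (future z (t + (a - d)) ω)) = block z d (r + a * n) := by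
          rw [htj]; rfl
        have e2 : (fun ω => (fun (x : Fin (t + 1) → Cube k) (s : Fin n) (j : Fin (d + 1)) =>
            x ⟨r + a * s + j, hlt s j⟩) (past z (t + 1) ω)) =
            fun ω => fun s : Fin n => block z d (r + a * s) ω := rfl
        rw [e1, e2, map_block hst] at this
        rw [← Measure.prod_swap, Measure.map_apply measurable_swap hA']
        refine le_trans (le_of_eq ?_) this
        congr 1
        ext ω
        simp only [Set.mem_ofPred_eq, Set.mem_preimage, Prod.swap]
        rw [← congrFun e1 ω]
        rfl
    have : IsProbabilityMeasure (μ.map fun ω => fun s : Fin n => block z d (r + a * s) ω) :=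
      Measure.isProbabilityMeasure_map hB.aemeasurable
    have hstep : (ν.prod (μ.map fun ω => fun s : Fin n => block z d (r + a * s) ω))
        (e.symm ⁻¹' A) ≤ (ν.prod (Measure.pi fun _ : Fin n => ν)) (e.symm ⁻¹' A)
          + n * betaCoeff μ z (a - d) := by
      rw [Measure.prod_apply hA', Measure.prod_apply hA']
      calc _ ≤ ∫⁻ x, ((Measure.pi fun _ : Fin n => ν) (Prod.mk x ⁻¹' (e.symm ⁻¹' A))
            + n * betaCoeff μ z (a - d)) ∂ν := by
            refine lintegral_mono fun x => ?_
            have hx : MeasurableSet (Prod.mk x ⁻¹' (e.symm ⁻¹' A)) := measurable_prodMk_left hA'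
            rw [Measure.map_apply hB hx]
            exact ih _ hx
        _ = _ := by
            rw [lintegral_add_right _ measurable_const, lintegral_const, measure_univ, mul_one]
    rw [hset, hpi]
    refine hbound.trans ((add_le_add_left hstep _).trans (le_of_eq ?_))
    push_cast
    ring

end Blocking

/-! ### Losses restricted to a cell of histories. -/

section WindowLoss

variable {k d : ℕ} {H : Type*}

/-- The loss at the last point of a block, restricted to the blocks whose first `d` points form
a history in `Q`. -/
def windowLoss (Q : Set (Fin d → Cube k)) (ℓ : H → Cube k → ℝ) (h : H)
    (s : Fin (d + 1) → Cube k) : ℝ :=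
  Q.indicator (fun _ => ℓ h (s (Fin.last d))) (Fin.init s)

lemma measurable_init : Measurable (Fin.init : (Fin (d + 1) → Cube k) → Fin d → Cube k) :=
  measurable_pi_lambda _ fun _ => measurable_pi_apply _

lemma windowLoss_eq_mul (Q : Set (Fin d → Cube k)) (ℓ : H → Cube k → ℝ) (h : H)
    (s : Fin (d + 1) → Cube k) :
    windowLoss Q ℓ h s = Q.indicator 1 (Fin.init s) * ℓ h (s (Fin.last d)) := by
  by_cases hs : Fin.init s ∈ Q <;> simp [windowLoss, hs]

lemma measurable_windowLoss {Q : Set (Fin d → Cube k)} (hQ : MeasurableSet Q)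
    {ℓ : H → Cube k → ℝ} (hℓ : ∀ h, Measurable (ℓ h)) (h : H) :
    Measurable (windowLoss Q ℓ h) := by
  have e : windowLoss Q ℓ h = fun s => Q.indicator 1 (Fin.init s) * ℓ h (s (Fin.last d)) :=
    funext fun s => windowLoss_eq_mul Q ℓ h s
  rw [e]
  exact ((measurable_one.indicator hQ).comp measurable_init).mul
    ((hℓ h).comp (measurable_pi_apply _))

lemma windowLoss_mem_Icc (Q : Set (Fin d → Cube k)) {ℓ : H → Cube k → ℝ}
    (hℓ : ∀ h y, ℓ h y ∈ Set.Icc (0 : ℝ) 1) (h : H) (s : Fin (d + 1) → Cube k) :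
    windowLoss Q ℓ h s ∈ Set.Icc (0 : ℝ) 1 := by
  by_cases hs : Fin.init s ∈ Q
  · simpa [windowLoss, hs] using hℓ h _
  · simp [windowLoss, hs]

/-- Multiplying the members of a cover by the indicator of the cell keeps their number and does not
increase any distance, so localisation costs nothing in entropy. -/
lemma coveringNumber_windowLoss_le (Q : Set (Fin d → Cube k)) {ℓ : H → Cube k → ℝ} {θ : ℝ}
    {n M : ℕ} (x : Fin n → Fin (d + 1) → Cube k)
    (h : coveringNumber θ (Set.range ℓ) (fun i => x i (Fin.last d)) ≤ M) :
    coveringNumber θ (Set.range (windowLoss Q ℓ)) x ≤ M := by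
  classical
  obtain ⟨V, hV, hc⟩ := exists_isCover_of_coveringNumber_le h
  refine coveringNumber_le_of_isCover (V := V.image fun v s =>
    Q.indicator (fun _ => v (s (Fin.last d))) (Fin.init s)) ?_ (Finset.card_image_le.trans hc)
  rintro _ ⟨f, rfl⟩
  obtain ⟨v, hv, hle⟩ := hV (ℓ f) ⟨f, rfl⟩
  refine ⟨_, Finset.mem_image_of_mem _ hv, le_trans ?_ hle⟩
  refine mul_le_mul_of_nonneg_left (Finset.sum_le_sum fun i _ => ?_) (by positivity)
  by_cases hs : Fin.init (x i) ∈ Q <;> simp [windowLoss, hs]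

lemma nullMeasurableSet_exists_lt_abs_sum {ℓ : H → Cube k → ℝ}
    (hℓ : ∀ h y, ℓ h y ∈ Set.Icc (0 : ℝ) 1) (hmeas : IsMeasurableClass ℓ) {P : Type*}
    [MeasurableSpace P] (ρ : Measure P) [IsFiniteMeasure ρ] {m : ℕ} {y : P → Fin m → Cube k}
    (hy : Measurable y) (w : Fin m → ℝ) (t : ℝ) :
    NullMeasurableSet {p | ∃ h, t < |∑ i, w i * ℓ h (y p i)|} ρ := by
  -- For empty `H` the real supremum is `0` by convention, which would make the identity below false
  -- when `t < 0`.
  rcases isEmpty_or_nonempty H with hH | hH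
  · simp
  have hbdd : ∀ p, BddAbove (Set.range fun h => |∑ i, w i * ℓ h (y p i)|) := by
    intro p
    refine ⟨∑ i, |w i|, ?_⟩
    rintro _ ⟨h, rfl⟩
    refine (Finset.abs_sum_le_sum_abs _ _).trans (Finset.sum_le_sum fun i _ => ?_)
    rw [abs_mul, abs_of_nonneg (hℓ h _).1]
    exact mul_le_of_le_one_right (abs_nonneg _) (hℓ h _).2
  have e : {p | ∃ h, t < |∑ i, w i * ℓ h (y p i)|} =
      {p | t < ⨆ h, |∑ i, w i * ℓ h (y p i)|} := by
    ext p
    exact (lt_ciSup_iff (hbdd p)).symm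
  rw [e]
  have hae : AEMeasurable (fun p => ⨆ h, |∑ i, w i * ℓ h (y p i)|) ρ :=
    (hmeas m w (ρ.map y) inferInstance).comp_measurable hy
  exact nullMeasurableSet_lt aemeasurable_const hae

/-- The measurability condition concerns fixed weights, whereas the indicators depend on the sample.
There are finitely many patterns of blocks lying in `Q`, and on each the sum has constant weights
`1`, `-1` or `0`. -/
lemma nullMeasurableSet_windowLoss {Q : Set (Fin d → Cube k)} (hQ : MeasurableSet Q)
    {ℓ : H → Cube k → ℝ} (hℓ : ∀ h y, ℓ h y ∈ Set.Icc (0 : ℝ) 1) (hmeas : IsMeasurableClass ℓ)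
    {n : ℕ} (ρ : Measure ((Fin n → Fin (d + 1) → Cube k) × (Fin n → Fin (d + 1) → Cube k)))
    [IsFiniteMeasure ρ] (t : ℝ) :
    NullMeasurableSet {p : (Fin n → Fin (d + 1) → Cube k) × (Fin n → Fin (d + 1) → Cube k) |
      ∃ h, t < |∑ i, (windowLoss Q ℓ h (p.1 i) - windowLoss Q ℓ h (p.2 i))|} ρ := by
  classical
  let S := Fin (d + 1) → Cube k
  have happ : ∀ i : Fin (n + n), Measurable fun p : (Fin n → S) × (Fin n → S) =>
      Fin.append p.1 p.2 i := by
    intro i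
    refine Fin.addCases (fun j => ?_) (fun j => ?_) i
    · simp only [Fin.append_left]; fun_prop
    · simp only [Fin.append_right]; fun_prop
  let y : (Fin n → S) × (Fin n → S) → Fin (n + n) → Cube k :=
    fun p i => Fin.append p.1 p.2 i (Fin.last d)
  have hy : Measurable y := measurable_pi_lambda _ fun i =>
    (measurable_pi_apply (Fin.last d)).comp (happ i)
  let c : (Fin n → S) × (Fin n → S) → Fin (n + n) → Prop :=
    fun p i => Fin.init (Fin.append p.1 p.2 i) ∈ Q
  have hc : Measurable c := measurable_pi_lambda _ fun i =>
    measurableSet_setOfPred.1 ((measurable_init.comp (happ i)) hQ)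
  let W : (Fin (n + n) → Prop) → Fin (n + n) → ℝ := fun π i =>
    Fin.append (fun _ : Fin n => (1 : ℝ)) (fun _ : Fin n => -1) i * (if π i then 1 else 0)
  have key : ∀ p : (Fin n → S) × (Fin n → S), ∀ h,
      ∑ i, (windowLoss Q ℓ h (p.1 i) - windowLoss Q ℓ h (p.2 i))
        = ∑ i, W (c p) i * ℓ h (y p i) := by
    intro p h
    rw [Fin.sum_univ_add, ← Finset.sum_add_distrib]
    refine Finset.sum_congr rfl fun i _ => ?_
    simp only [W, c, y, Fin.append_left, Fin.append_right, windowLoss_eq_mul,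
      Set.indicator_apply, Pi.one_apply]
    ring
  have e : {p : (Fin n → S) × (Fin n → S) |
      ∃ h, t < |∑ i, (windowLoss Q ℓ h (p.1 i) - windowLoss Q ℓ h (p.2 i))|} =
      ⋃ π, (c ⁻¹' {π} ∩ {p | ∃ h, t < |∑ i, W π i * ℓ h (y p i)|}) := by
    ext p
    simp [key]
  rw [e]
  refine NullMeasurableSet.iUnion fun π => NullMeasurableSet.inter ?_ ?_
  · exact (hc (measurableSet_singleton π)).nullMeasurableSet
  · exact nullMeasurableSet_exists_lt_abs_sum hℓ hmeas ρ hy (W π) t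

end WindowLoss

/-! ### Uniform deviations along the dependent sequence. -/

section WindowDeviation

lemma sum_range_mul_eq_sum_residues (g : ℕ → ℝ) (a n : ℕ) :
    ∑ u ∈ Finset.range (a * n), g u
      = ∑ r ∈ Finset.range a, ∑ s : Fin n, g (r + a * s) := by
  rw [Finset.sum_comm, Fin.sum_univ_eq_sum_range (fun s => ∑ r ∈ Finset.range a, g (r + a * s)) n]
  induction n with
  | zero => simp
  | succ n ih =>
    rw [Nat.mul_succ, Finset.sum_range_add, ih, Finset.sum_range_succ]
    simp [add_comm]

variable {Ω : Type*} [MeasurableSpace Ω] {k d : ℕ} {H : Type*}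

/-- Uniform deviations along a dependent sequence, for the loss restricted to a set of histories. -/
theorem measure_exists_windowDeviation_le (μ : Measure Ω) [IsProbabilityMeasure μ]
    {z : ℕ → Ω → Cube k} (hz : ∀ i, Measurable (z i)) (hst : IsStationary μ z)
    {ℓ : H → Cube k → ℝ} (hℓm : ∀ h, Measurable (ℓ h)) (hℓ : ∀ h y, ℓ h y ∈ Set.Icc (0 : ℝ) 1)
    (hmeas : IsMeasurableClass ℓ) {Q : Set (Fin d → Cube k)} (hQ : MeasurableSet Q)
    {a n N M : ℕ} (had : d ≤ a) (ha : 0 < a) {ε : ℝ} (hε : 0 < ε) (hn : 2 ≤ n * ε ^ 2)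
    (hN : a * n ≤ N) (hrem : (N : ℝ) - a * n ≤ ε * N)
    (hcov : maxCoveringNumber (ε / 8) (Set.range ℓ) (n + n) ≤ M) :
    μ {ω | ∃ h, 3 * ε * N < |∑ u ∈ Finset.range N, (windowLoss Q ℓ h (block z d u ω)
        - ∫ s, windowLoss Q ℓ h s ∂(μ.map (block z d 0)))|} ≤
      ENNReal.ofReal (1 / ε) * (ENNReal.ofReal (4 * M * Real.exp (-(n * ε ^ 2 / 32)))
        + n * betaCoeff μ z (a - d)) := by
  set ν := μ.map (block z d 0) with hν
  have : IsProbabilityMeasure ν :=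
    Measure.isProbabilityMeasure_map (measurable_block hz d 0).aemeasurable
  set F := windowLoss Q ℓ with hF
  have hFI : ∀ h s, F h s ∈ Set.Icc (0 : ℝ) 1 := windowLoss_mem_Icc Q hℓ
  have hmean : ∀ h, ∫ s, F h s ∂ν ∈ Set.Icc (0 : ℝ) 1 := by
    intro h
    refine ⟨integral_nonneg fun s => (hFI h s).1, ?_⟩
    calc ∫ s, F h s ∂ν ≤ ∫ _, (1 : ℝ) ∂ν := by
          refine integral_mono_of_nonneg (ae_of_all _ fun s => (hFI h s).1) (integrable_const _)
            (ae_of_all _ fun s => (hFI h s).2)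
      _ = 1 := by simp
  have hdev : ∀ h s, |F h s - ∫ s, F h s ∂ν| ≤ 1 := by
    intro h s
    rw [abs_le]
    constructor <;> linarith [(hFI h s).1, (hFI h s).2, (hmean h).1, (hmean h).2]
  set Bad := {x : Fin n → Fin (d + 1) → Cube k |
    ∃ h, n * ε < |∑ i, (F h (x i) - ∫ y, F h y ∂ν)|} with hBad
  have hiid : (Measure.pi fun _ : Fin n => ν) Bad ≤
      ENNReal.ofReal (4 * M * Real.exp (-(n * ε ^ 2 / 32))) := by
    refine measure_pi_exists_deviation_le ν (measurable_windowLoss hQ hℓm) hFI hε hn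
      (fun x => coveringNumber_windowLoss_le Q x ?_)
      (nullMeasurableSet_windowLoss hQ hℓ hmeas _ _)
    exact (le_iSup (fun x : Fin (n + n) → Cube k => coveringNumber (ε / 8) (Set.range ℓ) x) _).trans
      hcov
  set p := ENNReal.ofReal (4 * M * Real.exp (-(n * ε ^ 2 / 32))) + n * betaCoeff μ z (a - d)
  set E : ℕ → Set Ω := fun r =>
    toMeasurable μ {ω | (fun s : Fin n => block z d (r + a * s) ω) ∈ Bad} with hE
  have hEm : ∀ r, MeasurableSet (E r) := fun r => measurableSet_toMeasurable _ _
  have hEp : ∀ r, μ (E r) ≤ p := fun r => by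
    rw [hE, measure_toMeasurable]
    exact (measure_blocks_le μ hz hst had r n Bad).trans (add_le_add_left hiid _)
  -- The number of bad residue classes. Its mean is at most `a * p`, so Markov's inequality at level
  -- `a * ε` costs `1 / ε`, with no trace of `a`.
  set g : Ω → ℝ≥0∞ := fun ω => ∑ r ∈ Finset.range a, (E r).indicator 1 ω with hg
  have hgm : Measurable g := Finset.measurable_sum _ fun r _ => measurable_one.indicator (hEm r)
  have hgint : ∫⁻ ω, g ω ∂μ ≤ a * p := by
    rw [hg, lintegral_finsetSum _ fun r _ => measurable_one.indicator (hEm r)]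
    calc _ ≤ ∑ _r ∈ Finset.range a, p := by
          refine Finset.sum_le_sum fun r _ => ?_
          rw [lintegral_indicator_one (hEm r)]
          exact hEp r
      _ = a * p := by simp
  have hsub : {ω | ∃ h, 3 * ε * N < |∑ u ∈ Finset.range N, (F h (block z d u ω)
        - ∫ s, F h s ∂ν)|} ⊆ {ω | ENNReal.ofReal (a * ε) ≤ g ω} := by
    rintro ω ⟨h, hω⟩
    by_contra hlt
    have hlt : g ω < ENNReal.ofReal (a * ε) := not_le.1 hlt
    set gr : ℝ := ∑ r ∈ Finset.range a, (E r).indicator 1 ω with hgr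
    have hgr' : g ω = ENNReal.ofReal gr := by
      rw [hgr, ENNReal.ofReal_sum_of_nonneg fun r _ => Set.indicator_nonneg (by simp) _]
      refine Finset.sum_congr rfl fun r _ => ?_
      by_cases hr : ω ∈ E r <;> simp [hr]
    rw [hgr'] at hlt
    have hlt' : gr < a * ε := (ENNReal.ofReal_lt_ofReal_iff (by positivity)).1 hlt
    set D : ℕ → ℝ := fun u => F h (block z d u ω) - ∫ s, F h s ∂ν with hD
    have hD1 : ∀ u, |D u| ≤ 1 := fun u => hdev h _
    have hres : ∀ r ∈ Finset.range a, |∑ s : Fin n, D (r + a * s)|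
        ≤ n * ε + n * (E r).indicator 1 ω := by
      intro r _
      by_cases hr : ω ∈ E r
      · have h1 : |∑ s : Fin n, D (r + a * s)| ≤ n := by
          refine (Finset.abs_sum_le_sum_abs _ _).trans ?_
          refine (Finset.sum_le_sum fun s _ => hD1 _).trans ?_
          simp
        simp only [Set.indicator_of_mem hr, Pi.one_apply, mul_one]
        have : 0 ≤ n * ε := by positivity
        linarith
      · simp only [Set.indicator_of_notMem hr, mul_zero, add_zero]
        have h2 : ω ∉ {ω | (fun s : Fin n => block z d (r + a * s) ω) ∈ Bad} :=
          fun hω => hr (subset_toMeasurable _ _ hω)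
        have h3 : ¬ ∃ h, n * ε < |∑ s : Fin n, (F h (block z d (r + a * s) ω)
          - ∫ y, F h y ∂ν)| := h2
        push Not at h3
        exact h3 h
    -- The three summands are the good classes, the bad classes (each term being at most `1`) and
    -- the incomplete last stretch; each is at most `ε * N`.
    have htot : |∑ u ∈ Finset.range N, D u| ≤ (a * (n * ε) + n * gr) + (N - a * n) := by
      obtain ⟨m, rfl⟩ : ∃ m, N = a * n + m := ⟨N - a * n, by omega⟩
      rw [Finset.sum_range_add]
      refine (abs_add_le _ _).trans (add_le_add ?_ ?_)
      · rw [sum_range_mul_eq_sum_residues]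
        refine (Finset.abs_sum_le_sum_abs _ _).trans ((Finset.sum_le_sum hres).trans ?_)
        rw [Finset.sum_add_distrib, hgr, Finset.mul_sum]
        simp only [Finset.sum_const, Finset.card_range, nsmul_eq_mul, le_refl]
      · refine (Finset.abs_sum_le_sum_abs _ _).trans
          ((Finset.sum_le_sum fun s _ => hD1 _).trans ?_)
        simp
    have han : (a : ℝ) * n ≤ N := by exact_mod_cast hN
    have hn0 : (0 : ℝ) ≤ n := by positivity
    have h5 : n * gr ≤ n * (a * ε) := by gcongr
    have h6 : (a : ℝ) * n * ε ≤ N * ε := by gcongr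
    have hω' : 3 * ε * N < |∑ u ∈ Finset.range N, D u| := hω
    nlinarith
  have haε : ENNReal.ofReal (a * ε) ≠ 0 := by
    have : (0 : ℝ) < a * ε := by positivity
    exact (ENNReal.ofReal_pos.2 this).ne'
  calc _ ≤ μ {ω | ENNReal.ofReal (a * ε) ≤ g ω} := measure_mono hsub
    _ ≤ (∫⁻ ω, g ω ∂μ) / ENNReal.ofReal (a * ε) :=
        meas_ge_le_lintegral_div hgm.aemeasurable haε (by finiteness)
    _ ≤ (a * p) / ENNReal.ofReal (a * ε) := by gcongr
    _ = ENNReal.ofReal (1 / ε) * p := by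
        rw [ENNReal.ofReal_mul (by positivity), ENNReal.ofReal_natCast,
          ENNReal.mul_div_mul_left _ _ (by exact_mod_cast ha.ne') (by finiteness),
          one_div, ENNReal.ofReal_inv_of_pos hε, ENNReal.div_eq_inv_mul]

end WindowDeviation

/-! ### From cells to kernel weights, uniformly in the evaluation point. -/

section Kernel

variable {k d : ℕ} {K : HistSpace d k → ℝ} {K₁ K₂ L γ : ℝ}

lemma IsSmoothingKernel.bound_nonneg (hK : IsSmoothingKernel K K₁ K₂ L γ) : 0 ≤ K₁ :=
  (hK.nonneg 0).trans (hK.le_bound 0)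

lemma IsSmoothingKernel.abs_sub_le (hK : IsSmoothingKernel K K₁ K₂ L γ) {x y : HistSpace d k}
    {r : ℝ} (h : ‖x - y‖ ≤ r) : |K x - K y| ≤ |L| * r ^ γ := by
  refine (hK.holder x y).trans ?_
  have := hK.order_pos
  gcongr
  exact le_abs_self L

lemma IsSmoothingKernel.continuous (hK : IsSmoothingKernel K K₁ K₂ L γ) : Continuous K := by
  rw [continuous_iff_continuousAt]
  intro x
  rw [ContinuousAt, tendsto_iff_dist_tendsto_zero]
  have h0 : Tendsto (fun y => L * ‖y - x‖ ^ γ) (𝓝 x) (𝓝 (L * ‖x - x‖ ^ γ)) := by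
    have hc : Continuous fun y => L * ‖y - x‖ ^ γ :=
      continuous_const.mul ((by fun_prop : Continuous fun y => ‖y - x‖).rpow_const
        fun _ => Or.inr hK.order_pos.le)
    exact hc.tendsto x
  rw [sub_self, norm_zero, Real.zero_rpow hK.order_pos.ne', mul_zero] at h0
  exact squeeze_zero (fun _ => dist_nonneg) (fun y => by rw [Real.dist_eq]; exact hK.holder y x) h0

lemma continuous_toVec : Continuous (toVec : (Fin d → Cube k) → HistSpace d k) := by
  unfold toVec
  fun_prop

/-- A finite-valued measurable approximation of the identity on the histories. -/
lemma exists_simpleFunc_norm_sub_le (d k : ℕ) {δ : ℝ} (hδ : 0 < δ) :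
    ∃ v : SimpleFunc (HistSpace d k) (HistSpace d k),
      ∀ x : Fin d → Cube k, ‖toVec x - v (toVec x)‖ ≤ δ := by
  have hc : IsCompact (Set.range (toVec : (Fin d → Cube k) → HistSpace d k)) :=
    isCompact_range continuous_toVec
  set e := TopologicalSpace.denseSeq (HistSpace d k)
  obtain ⟨t, ht⟩ := hc.elim_finite_subcover (fun i => Metric.ball (e i) δ)
    (fun i => Metric.isOpen_ball) (fun x _ => by
      obtain ⟨i, hi⟩ := (TopologicalSpace.denseRange_denseSeq (HistSpace d k)).exists_dist_lt x hδ
      exact Set.mem_iUnion.2 ⟨i, hi⟩)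
  refine ⟨SimpleFunc.nearestPt e (t.sup id), fun x => ?_⟩
  obtain ⟨i, hi, hx⟩ : ∃ i ∈ t, toVec x ∈ Metric.ball (e i) δ := by
    simpa using ht ⟨x, rfl⟩
  have h := SimpleFunc.edist_nearestPt_le e (toVec x) (Finset.le_sup (f := id) hi)
  simp only [id] at h
  rw [edist_dist, edist_dist, ENNReal.ofReal_le_ofReal_iff dist_nonneg] at h
  rw [← dist_eq_norm, dist_comm]
  exact h.trans (by rw [dist_comm]; exact (Metric.mem_ball.1 hx).le)

variable {H : Type*}

/-- The loss at the last point of a block, weighted by the kernel at the first `d` points. -/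
def kernelLoss (K : HistSpace d k → ℝ) (ℓ : H → Cube k → ℝ) (b : ℝ) (h : H) (x : HistSpace d k)
    (s : Fin (d + 1) → Cube k) : ℝ :=
  ℓ h (s (Fin.last d)) * K (b⁻¹ • (x - toVec (Fin.init s)))

lemma measurable_kernelLoss (hK : IsSmoothingKernel K K₁ K₂ L γ) {ℓ : H → Cube k → ℝ}
    (hℓ : ∀ h, Measurable (ℓ h)) (b : ℝ) (h : H) (x : HistSpace d k) :
    Measurable (kernelLoss K ℓ b h x) := by
  refine ((hℓ h).comp (measurable_pi_apply (Fin.last d))).mul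
    (hK.continuous.measurable.comp (?_ : Measurable fun s : Fin (d + 1) → Cube k =>
      b⁻¹ • (x - toVec (Fin.init s))))
  have hc : Continuous fun y : Fin d → Cube k => b⁻¹ • (x - toVec y) :=
    by
    have := continuous_toVec (d := d) (k := k)
    fun_prop
  exact hc.measurable.comp measurable_init

lemma kernelLoss_mem_Icc (hK : IsSmoothingKernel K K₁ K₂ L γ) {ℓ : H → Cube k → ℝ}
    (hℓ : ∀ h y, ℓ h y ∈ Set.Icc (0 : ℝ) 1) (b : ℝ) (h : H) (x : HistSpace d k)
    (s : Fin (d + 1) → Cube k) : kernelLoss K ℓ b h x s ∈ Set.Icc 0 K₁ :=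
  ⟨mul_nonneg (hℓ h _).1 (hK.nonneg _),
    (mul_le_of_le_one_left (hK.nonneg _) (hℓ h _).2).trans (hK.le_bound _)⟩

lemma integrable_kernelLoss (hK : IsSmoothingKernel K K₁ K₂ L γ) {ℓ : H → Cube k → ℝ}
    (hℓm : ∀ h, Measurable (ℓ h)) (hℓ : ∀ h y, ℓ h y ∈ Set.Icc (0 : ℝ) 1) (b : ℝ) (h : H)
    (x : HistSpace d k) (ν : Measure (Fin (d + 1) → Cube k)) [IsFiniteMeasure ν] :
    Integrable (kernelLoss K ℓ b h x) ν :=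
  Integrable.of_mem_Icc 0 K₁ (measurable_kernelLoss hK hℓm b h x).aemeasurable
    (ae_of_all _ fun s => kernelLoss_mem_Icc hK hℓ b h x s)

variable {Ω : Type*} [MeasurableSpace Ω]

/-- Only the cell containing the history contributes to the sum, so the sum is the kernel loss with
the history moved to the representative of its cell. After rescaling, the move has length at most `δ
/ b`, and Hölder continuity applies. -/
lemma abs_kernelLoss_sub_sum_windowLoss_le (hK : IsSmoothingKernel K K₁ K₂ L γ)
    {ℓ : H → Cube k → ℝ} (hℓ : ∀ h y, ℓ h y ∈ Set.Icc (0 : ℝ) 1)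
    {δ b : ℝ} (hb : 0 < b) {v : SimpleFunc (HistSpace d k) (HistSpace d k)}
    (hv : ∀ x : Fin d → Cube k, ‖toVec x - v (toVec x)‖ ≤ δ) (h : H) (x : HistSpace d k)
    (s : Fin (d + 1) → Cube k) :
    |kernelLoss K ℓ b h x s
      - ∑ u ∈ v.range, K (b⁻¹ • (x - u)) * windowLoss {y | v (toVec y) = u} ℓ h s|
      ≤ |L| * (δ / b) ^ γ := by
  have e : ∑ u ∈ v.range, K (b⁻¹ • (x - u)) * windowLoss {y | v (toVec y) = u} ℓ h s
      = ℓ h (s (Fin.last d)) * K (b⁻¹ • (x - v (toVec (Fin.init s)))) := by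
    rw [Finset.sum_eq_single (v (toVec (Fin.init s)))]
    · rw [windowLoss_eq_mul, Set.indicator_of_mem (by simp)]
      simp only [Pi.one_apply]; ring
    · intro u _ hu
      rw [windowLoss_eq_mul, Set.indicator_of_notMem (by simpa using hu.symm)]
      simp
    · intro hn
      exact absurd (SimpleFunc.mem_range_self v _) hn
  rw [e, kernelLoss, ← mul_sub, abs_mul, abs_of_nonneg (hℓ h _).1]
  refine (mul_le_of_le_one_left (abs_nonneg _) (hℓ h _).2).trans (hK.abs_sub_le ?_)
  rw [← smul_sub, norm_smul, norm_inv, Real.norm_eq_abs, abs_of_pos hb, div_eq_inv_mul,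
    sub_sub_sub_cancel_left, norm_sub_rev]
  gcongr
  exact hv _

/-- Uniform deviations, over the class and over all points, of kernel weighted sums. -/
theorem measure_exists_kernelDeviation_le (hK : IsSmoothingKernel K K₁ K₂ L γ)
    (μ : Measure Ω) [IsProbabilityMeasure μ]
    {z : ℕ → Ω → Cube k} (hz : ∀ i, Measurable (z i)) (hst : IsStationary μ z)
    {ℓ : H → Cube k → ℝ} (hℓm : ∀ h, Measurable (ℓ h)) (hℓ : ∀ h y, ℓ h y ∈ Set.Icc (0 : ℝ) 1)
    (hmeas : IsMeasurableClass ℓ)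
    {a n N M : ℕ} (had : d ≤ a) (ha : 0 < a) {ε : ℝ} (hε : 0 < ε) (hn : 2 ≤ n * ε ^ 2)
    (hN : a * n ≤ N) (hrem : (N : ℝ) - a * n ≤ ε * N)
    (hcov : maxCoveringNumber (ε / 8) (Set.range ℓ) (n + n) ≤ M)
    {δ b : ℝ} (hb : 0 < b) {v : SimpleFunc (HistSpace d k) (HistSpace d k)}
    (hv : ∀ x : Fin d → Cube k, ‖toVec x - v (toVec x)‖ ≤ δ) :
    μ {ω | ∃ h x, (2 * (|L| * (δ / b) ^ γ) + v.range.card * (K₁ * (3 * ε))) * N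
        < |∑ u ∈ Finset.range N, (kernelLoss K ℓ b h x (block z d u ω)
        - ∫ s, kernelLoss K ℓ b h x s ∂(μ.map (block z d 0)))|} ≤
      v.range.card * (ENNReal.ofReal (1 / ε) *
        (ENNReal.ofReal (4 * M * Real.exp (-(n * ε ^ 2 / 32))) + n * betaCoeff μ z (a - d))) := by
  set ν := μ.map (block z d 0) with hν
  have : IsProbabilityMeasure ν :=
    Measure.isProbabilityMeasure_map (measurable_block hz d 0).aemeasurable
  set Q : HistSpace d k → Set (Fin d → Cube k) := fun u => {y | v (toVec y) = u} with hQ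
  have hQm : ∀ u, MeasurableSet (Q u) := fun u =>
    (v.measurable.comp continuous_toVec.measurable) (measurableSet_singleton u)
  have hWint : ∀ u h, Integrable (windowLoss (Q u) ℓ h) ν := fun u h =>
    Integrable.of_mem_Icc 0 1 (measurable_windowLoss (hQm u) hℓm h).aemeasurable
      (ae_of_all _ fun s => windowLoss_mem_Icc (Q u) hℓ h s)
  set Bad : HistSpace d k → Set Ω := fun u =>
    {ω | ∃ h, 3 * ε * N < |∑ i ∈ Finset.range N, (windowLoss (Q u) ℓ h (block z d i ω)
        - ∫ s, windowLoss (Q u) ℓ h s ∂ν)|} with hBad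
  -- The bad events of the cells do not involve `x`: the point enters only through the weights `K
  -- (b⁻¹ • (x - u))`, which lie between `0` and `K₁`.
  have hsub : {ω | ∃ h x, (2 * (|L| * (δ / b) ^ γ) + v.range.card * (K₁ * (3 * ε))) * N
        < |∑ u ∈ Finset.range N, (kernelLoss K ℓ b h x (block z d u ω)
        - ∫ s, kernelLoss K ℓ b h x s ∂ν)|} ⊆ ⋃ u ∈ v.range, Bad u := by
    rintro ω ⟨h, x, hω⟩
    by_contra hnot
    have hgood : ∀ u ∈ v.range, |∑ i ∈ Finset.range N, (windowLoss (Q u) ℓ h (block z d i ω)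
        - ∫ s, windowLoss (Q u) ℓ h s ∂ν)| ≤ 3 * ε * N := by
      intro u hu
      by_contra hlt
      exact hnot (Set.mem_biUnion hu ⟨h, not_le.1 hlt⟩)
    set κ := |L| * (δ / b) ^ γ with hκ
    set A : (Fin (d + 1) → Cube k) → ℝ := fun s =>
      ∑ u ∈ v.range, K (b⁻¹ • (x - u)) * windowLoss (Q u) ℓ h s with hA
    have hclose : ∀ s, |kernelLoss K ℓ b h x s - A s| ≤ κ := fun s =>
      abs_kernelLoss_sub_sum_windowLoss_le hK hℓ hb hv h x s
    have hAint : Integrable A ν := integrable_finsetSum _ fun u _ => (hWint u h).const_mul _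
    have hKint := integrable_kernelLoss hK hℓm hℓ b h x ν
    have hclose' : |∫ s, kernelLoss K ℓ b h x s ∂ν - ∫ s, A s ∂ν| ≤ κ := by
      rw [← integral_sub hKint hAint]
      have := norm_integral_le_of_norm_le_const (μ := ν)
        (f := fun s => kernelLoss K ℓ b h x s - A s) (ae_of_all _ hclose)
      simpa using this
    have hAmean : ∫ s, A s ∂ν = ∑ u ∈ v.range, K (b⁻¹ • (x - u)) *
        ∫ s, windowLoss (Q u) ℓ h s ∂ν := by
      rw [hA, integral_finsetSum _ fun u _ => (hWint u h).const_mul _]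
      simp_rw [integral_const_mul]
    have hAsum : |∑ i ∈ Finset.range N, (A (block z d i ω) - ∫ s, A s ∂ν)|
        ≤ v.range.card * (K₁ * (3 * ε)) * N := by
      have e : ∑ i ∈ Finset.range N, (A (block z d i ω) - ∫ s, A s ∂ν)
          = ∑ u ∈ v.range, K (b⁻¹ • (x - u)) * ∑ i ∈ Finset.range N,
            (windowLoss (Q u) ℓ h (block z d i ω) - ∫ s, windowLoss (Q u) ℓ h s ∂ν) := by
        simp_rw [Finset.mul_sum]
        rw [Finset.sum_comm]
        refine Finset.sum_congr rfl fun i _ => ?_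
        rw [hAmean, hA, ← Finset.sum_sub_distrib]
        exact Finset.sum_congr rfl fun u _ => by ring
      rw [e]
      refine (Finset.abs_sum_le_sum_abs _ _).trans ?_
      have : ∀ u ∈ v.range, |K (b⁻¹ • (x - u)) * ∑ i ∈ Finset.range N,
            (windowLoss (Q u) ℓ h (block z d i ω) - ∫ s, windowLoss (Q u) ℓ h s ∂ν)|
            ≤ K₁ * (3 * ε * N) := by
        intro u hu
        rw [abs_mul, abs_of_nonneg (hK.nonneg _)]
        exact mul_le_mul (hK.le_bound _) (hgood u hu) (abs_nonneg _) hK.bound_nonneg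
      refine (Finset.sum_le_sum this).trans (le_of_eq ?_)
      rw [Finset.sum_const, nsmul_eq_mul]
      ring
    have hdiff : |∑ u ∈ Finset.range N, (kernelLoss K ℓ b h x (block z d u ω)
        - ∫ s, kernelLoss K ℓ b h x s ∂ν)
        - ∑ i ∈ Finset.range N, (A (block z d i ω) - ∫ s, A s ∂ν)| ≤ N * (2 * κ) := by
      rw [← Finset.sum_sub_distrib]
      refine (Finset.abs_sum_le_sum_abs _ _).trans ?_
      have : ∀ i ∈ Finset.range N, |kernelLoss K ℓ b h x (block z d i ω)
          - ∫ s, kernelLoss K ℓ b h x s ∂ν - (A (block z d i ω) - ∫ s, A s ∂ν)| ≤ 2 * κ := by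
        intro i _
        have h1 := hclose (block z d i ω)
        rw [abs_le] at h1 hclose' ⊢
        constructor <;> linarith
      refine (Finset.sum_le_sum this).trans (le_of_eq ?_)
      rw [Finset.sum_const, nsmul_eq_mul, Finset.card_range]
    have := abs_sub_abs_le_abs_sub (∑ u ∈ Finset.range N, (kernelLoss K ℓ b h x (block z d u ω)
        - ∫ s, kernelLoss K ℓ b h x s ∂ν))
      (∑ i ∈ Finset.range N, (A (block z d i ω) - ∫ s, A s ∂ν))
    nlinarith
  calc _ ≤ μ (⋃ u ∈ v.range, Bad u) := measure_mono hsub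
    _ ≤ ∑ u ∈ v.range, μ (Bad u) := measure_biUnion_finset_le _ _
    _ ≤ ∑ _u ∈ v.range, (ENNReal.ofReal (1 / ε) *
        (ENNReal.ofReal (4 * M * Real.exp (-(n * ε ^ 2 / 32))) + n * betaCoeff μ z (a - d))) :=
        Finset.sum_le_sum fun u _ => measure_exists_windowDeviation_le μ hz hst hℓm hℓ hmeas
          (hQm u) had ha hε hn hN hrem hcov
    _ = _ := by rw [Finset.sum_const, nsmul_eq_mul]

end Kernel

/-! ### The number of blocks needed for a given accuracy and minimal bandwidth. -/

section SampleSize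

lemma eventually_const_mul_covering_mul_exp_le {f : ℕ → ℕ}
    (hf : Tendsto (fun n : ℕ => Real.log (f n : ℝ) / (n : ℝ)) atTop (𝓝 0)) (C : ℝ) {c : ℝ}
    (hc : 0 < c) (p : ℕ) :
    ∀ᶠ n : ℕ in atTop,
      C * (max (f (n + n)) 1 : ℕ) * Real.exp (-(n * c)) ≤ 1 / (n : ℝ) ^ p := by
  have h2 : Tendsto (fun n : ℕ => n + n) atTop atTop :=
    tendsto_atTop_mono (fun n => Nat.le_add_left n n) tendsto_id
  have h3 : ∀ᶠ n : ℕ in atTop, Real.log (f (n + n) : ℝ) / ((n + n : ℕ) : ℝ) < c / 4 :=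
    (hf.comp h2).eventually_lt_const (by positivity)
  have h4 : Tendsto (fun n : ℕ => |C| * ((n : ℝ) ^ p * Real.exp (-(c / 2) * n))) atTop (𝓝 0) := by
    have := (Real.tendsto_pow_mul_exp_neg_atTop_nhds_zero p).comp
      ((tendsto_natCast_atTop_atTop (R := ℝ)).const_mul_atTop (show 0 < c / 2 by positivity))
    have := this.const_mul (|C| / (c / 2) ^ p)
    rw [mul_zero] at this
    refine this.congr fun n => ?_
    simp only [Function.comp_apply]
    rw [mul_pow]
    field_simp
  filter_upwards [h3, h4.eventually_lt_const zero_lt_one, eventually_gt_atTop 0] with n h3 h4 hn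
  have hn' : (0 : ℝ) < n := by exact_mod_cast hn
  -- Subexponential growth at `2n` leaves half of the exponential decay to absorb the constant and
  -- the power. The value `0`, whose logarithm is `0` by convention, is treated separately.
  have hM : ((max (f (n + n)) 1 : ℕ) : ℝ) ≤ Real.exp (n * c / 2) := by
    rcases Nat.eq_zero_or_pos (f (n + n)) with h0 | h0
    · rw [h0]
      simpa using by positivity
    · rw [max_eq_left h0, ← Real.log_le_iff_le_exp (by exact_mod_cast h0)]
      rw [div_lt_iff₀ (by positivity)] at h3
      push_cast at h3
      linarith
  rw [le_div_iff₀ (by positivity)]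
  calc C * (max (f (n + n)) 1 : ℕ) * Real.exp (-(n * c)) * (n : ℝ) ^ p
      ≤ |C| * Real.exp (n * c / 2) * Real.exp (-(n * c)) * (n : ℝ) ^ p := by
        gcongr
        exact le_abs_self C
    _ = |C| * ((n : ℝ) ^ p * Real.exp (-(c / 2) * n)) := by
        rw [mul_assoc |C|, ← Real.exp_add]
        ring_nf
    _ ≤ 1 := h4.le

/-- For a fixed accuracy and a fixed lower bound for the bandwidth, enough blocks make large
deviations unlikely, uniformly over the processes and the classes. -/
theorem exists_sampleSize {k d : ℕ} {K : HistSpace d k → ℝ} {K₁ K₂ L γ : ℝ}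
    (hK : IsSmoothingKernel K K₁ K₂ L γ) (cov : ℝ → ℕ → ℕ)
    (hcov : ∀ θ : ℝ, 0 < θ → Tendsto (fun n : ℕ => Real.log (cov θ n : ℝ) / (n : ℝ)) atTop (𝓝 0))
    {τ b₁ : ℝ} (hτ : 0 < τ) (hb₁ : 0 < b₁) :
    ∃ Φ : ℕ, ∀ n, Φ ≤ n → ∀ N, n ^ 2 ≤ N →
      ∀ (Ω : Type*) [MeasurableSpace Ω] (μ : Measure Ω) [IsProbabilityMeasure μ]
        (z : ℕ → Ω → Cube k), (∀ i, Measurable (z i)) → IsStationary μ z →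
      ∀ (H : Type*) (ℓ : H → Cube k → ℝ), (∀ h, Measurable (ℓ h)) →
        (∀ h y, ℓ h y ∈ Set.Icc (0 : ℝ) 1) → IsMeasurableClass ℓ →
        (∀ θ : ℝ, 0 < θ → ∀ n : ℕ,
          maxCoveringNumber θ (Set.range ℓ) n ≤ (max (cov θ n) 1 : ℕ)) →
      ∀ b, b₁ ≤ b →
        μ {ω | ∃ h x, τ * N < |∑ u ∈ Finset.range N, (kernelLoss K ℓ b h x (block z d u ω)
          - ∫ s, kernelLoss K ℓ b h x s ∂(μ.map (block z d 0)))|} ≤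
        ENNReal.ofReal (1 / (n : ℝ) ^ 4) + (n : ℝ≥0∞) ^ 2 * betaCoeff μ z (N / n - d) := by
  -- The cell size makes twice the Hölder error at most `τ / 2` for every `b ≥ b₁`. It fixes the
  -- number `G` of cells, after which `ε` below makes the `G` cell deviations contribute at most `τ
  -- / 2`.
  set δ : ℝ := b₁ * (τ / (4 * (|L| + 1))) ^ (1 / γ) with hδ
  have hγ := hK.order_pos
  have hδ0 : 0 < δ := by positivity
  obtain ⟨v, hv⟩ := exists_simpleFunc_norm_sub_le d k hδ0
  set G : ℕ := v.range.card with hG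
  set ε : ℝ := τ / (6 * (K₁ + 1) * (G + 1)) with hε
  have hK₁ := hK.bound_nonneg
  have hε0 : 0 < ε := by positivity
  have hnat := tendsto_natCast_atTop_atTop (R := ℝ)
  -- With `1 / ε ≤ n` and `n² ≤ N` the remainder of `N` modulo `n` is at most `ε * N`; with `G / ε ≤
  -- n` the mixing term `(G / ε) * n * β` becomes `n² * β`.
  have hev : ∀ᶠ n : ℕ in atTop, d ≤ n ∧ 0 < n ∧ 2 / ε ^ 2 ≤ (n : ℝ) ∧ 1 / ε ≤ (n : ℝ) ∧
      G / ε ≤ (n : ℝ) ∧ (G / ε * 4) * (max (cov (ε / 8) (n + n)) 1 : ℕ) *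
        Real.exp (-(n * (ε ^ 2 / 32))) ≤ 1 / (n : ℝ) ^ 4 := by
    filter_upwards [eventually_ge_atTop d, eventually_gt_atTop 0,
      hnat.eventually_ge_atTop (2 / ε ^ 2), hnat.eventually_ge_atTop (1 / ε),
      hnat.eventually_ge_atTop (G / ε), eventually_const_mul_covering_mul_exp_le
        (hcov (ε / 8) (by positivity)) (G / ε * 4) (c := ε ^ 2 / 32) (by positivity) 4]
      with n h1 h2 h3 h4 h5 h6
    exact ⟨h1, h2, h3, h4, h5, h6⟩
  obtain ⟨Φ, hΦ⟩ := eventually_atTop.1 hev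
  refine ⟨Φ, fun n hn N hN Ω _ μ _ z hz hst H ℓ hℓm hℓ hmeas hcovℓ b hb => ?_⟩
  obtain ⟨h1, h2, h3, h4, h5, h6⟩ := hΦ n hn
  have hb0 : 0 < b := hb₁.trans_le hb
  have hn0 : (0 : ℝ) < n := by exact_mod_cast h2
  have hna : n ≤ N / n := (Nat.le_div_iff_mul_le h2).2 (by nlinarith)
  have hNr : (n : ℝ) ^ 2 ≤ N := by exact_mod_cast hN
  have hrem : (N : ℝ) - (N / n : ℕ) * n ≤ ε * N := by
    have e1 : (N : ℝ) - (N / n : ℕ) * n = (N % n : ℕ) := by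
      have := Nat.div_add_mod N n
      have h' : (n : ℝ) * (N / n : ℕ) + (N % n : ℕ) = N := by exact_mod_cast this
      linarith
    have e2 : ((N % n : ℕ) : ℝ) ≤ n := by exact_mod_cast (Nat.mod_lt _ h2).le
    rw [div_le_iff₀ hε0] at h4
    rw [e1]
    nlinarith
  have key := measure_exists_kernelDeviation_le hK μ hz hst hℓm hℓ hmeas (h1.trans hna)
    (h2.trans_le hna) hε0 (by rw [div_le_iff₀ (by positivity)] at h3; exact h3)
    (Nat.div_mul_le_self N n) hrem (hcovℓ (ε / 8) (by positivity) (n + n)) hb0 hv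
  refine le_trans (measure_mono ?_) (key.trans ?_)
  · rintro ω ⟨h, x, hω⟩
    refine ⟨h, x, lt_of_le_of_lt ?_ hω⟩
    gcongr
    have q1 : |L| * (δ / b) ^ γ ≤ τ / 4 := by
      have : (δ / b) ^ γ ≤ τ / (4 * (|L| + 1)) := by
        calc (δ / b) ^ γ ≤ (δ / b₁) ^ γ := by gcongr
          _ = τ / (4 * (|L| + 1)) := by
            rw [hδ, mul_div_cancel_left₀ _ hb₁.ne', ← Real.rpow_mul (by positivity),
              one_div_mul_cancel hγ.ne', Real.rpow_one]
      calc |L| * (δ / b) ^ γ ≤ (|L| + 1) * (τ / (4 * (|L| + 1))) := by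
            gcongr; linarith
        _ = τ / 4 := by field_simp
    have q2 : G * (K₁ * (3 * ε)) ≤ τ / 2 := by
      calc G * (K₁ * (3 * ε)) ≤ (G + 1) * ((K₁ + 1) * (3 * ε)) := by
            gcongr <;> linarith
        _ = τ / 2 := by rw [hε]; field_simp; norm_num
    linarith
  · rw [← mul_assoc, mul_add]
    have e : (G : ℝ≥0∞) * ENNReal.ofReal (1 / ε) = ENNReal.ofReal (G / ε) := by
      rw [← ENNReal.ofReal_natCast, ← ENNReal.ofReal_mul (by positivity)]
      ring_nf
    rw [e, ← ENNReal.ofReal_mul (by positivity)]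
    refine add_le_add (ENNReal.ofReal_le_ofReal (le_trans (le_of_eq ?_) h6)) ?_
    · ring_nf
    · rw [pow_two, mul_assoc]
      gcongr
      rw [← ENNReal.ofReal_natCast n]
      exact ENNReal.ofReal_le_ofReal h5

end SampleSize

/-! ### The kernel mass in the cube and the bias. -/

section Bias

variable {k d : ℕ}

/-- The unit cube of `ℝ^{kd}`. -/
def unitCube (d k : ℕ) : Set (HistSpace d k) := {x | ∀ p, x p ∈ Set.Icc (0 : ℝ) 1}

/-- The points of the unit cube at distance at least `τ` from its boundary. -/
def innerCube (d k : ℕ) (τ : ℝ) : Set (HistSpace d k) := {x | ∀ p, x p ∈ Set.Icc τ (1 - τ)}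

lemma toVec_mem_unitCube (x : Fin d → Cube k) : toVec x ∈ unitCube d k := fun p => (x p.1 p.2).2

lemma measurableSet_innerCube (d k : ℕ) (τ : ℝ) : MeasurableSet (innerCube d k τ) := by
  have e : innerCube d k τ = ⋂ p, {x : HistSpace d k | x p ∈ Set.Icc τ (1 - τ)} := by
    ext x; simp [innerCube]
  rw [e]
  exact MeasurableSet.iInter fun p =>
    (EuclideanSpace.proj p : HistSpace d k →L[ℝ] ℝ).continuous.measurable measurableSet_Icc

lemma unitCube_eq_innerCube (d k : ℕ) : unitCube d k = innerCube d k 0 := by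
  simp [unitCube, innerCube]

lemma measurableSet_unitCube (d k : ℕ) : MeasurableSet (unitCube d k) :=
  unitCube_eq_innerCube d k ▸ measurableSet_innerCube d k 0

lemma norm_le_sum_abs (v : HistSpace d k) : ‖v‖ ≤ ∑ p, |v p| := by
  rw [EuclideanSpace.norm_eq]
  refine Real.sqrt_le_iff.2 ⟨Finset.sum_nonneg fun _ _ => abs_nonneg _, ?_⟩
  exact Finset.sum_sq_le_sq_sum_of_nonneg fun _ _ => abs_nonneg _

lemma norm_toVec_sub_toVec_le (x y : Fin d → Cube k) :
    ‖toVec x - toVec y‖ ≤ Fintype.card (Fin d × Fin k) := by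
  refine (norm_le_sum_abs _).trans ?_
  have : ∀ p ∈ (Finset.univ : Finset (Fin d × Fin k)), |(toVec x - toVec y) p| ≤ 1 := by
    intro p _
    have h1 := toVec_mem_unitCube x p
    have h2 := toVec_mem_unitCube y p
    simp only [PiLp.sub_apply]
    rw [abs_le]
    constructor <;> linarith [h1.1, h1.2, h2.1, h2.2]
  refine (Finset.sum_le_sum this).trans ?_
  simp

lemma volume_innerCube (d k : ℕ) (τ : ℝ) :
    volume (innerCube d k τ) = ENNReal.ofReal (1 - 2 * τ) ^ Fintype.card (Fin d × Fin k) := by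
  have e : innerCube d k τ = (fun x : HistSpace d k => x.ofLp) ⁻¹'
      (Set.univ.pi fun _ => Set.Icc τ (1 - τ)) := by
    ext x; simp only [innerCube, Set.mem_ofPred_eq, Set.mem_preimage, Set.mem_univ_pi]
  rw [e, (PiLp.volume_preserving_ofLp (Fin d × Fin k)).measure_preimage
    (MeasurableSet.univ_pi fun _ => measurableSet_Icc).nullMeasurableSet, volume_pi_pi]
  simp only [Real.volume_Icc, Finset.prod_const, Finset.card_univ]
  congr 2
  ring

lemma volume_unitCube (d k : ℕ) : volume (unitCube d k) = 1 := by
  rw [unitCube_eq_innerCube, volume_innerCube]; simp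

lemma exists_volume_unitCube_diff_innerCube_le (d k : ℕ) {η : ℝ≥0∞} (hη : 0 < η) :
    ∃ τ : ℝ, 0 < τ ∧ volume (unitCube d k \ innerCube d k τ) ≤ η := by
  have ht : Tendsto (fun τ : ℝ => 1 - ENNReal.ofReal (1 - 2 * τ) ^ Fintype.card (Fin d × Fin k))
      (𝓝[>] 0) (𝓝 (1 - ENNReal.ofReal (1 - 2 * 0) ^ Fintype.card (Fin d × Fin k))) := by
    have h1 : Tendsto (fun τ : ℝ => ENNReal.ofReal (1 - 2 * τ)) (𝓝[>] 0)
        (𝓝 (ENNReal.ofReal (1 - 2 * 0))) := by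
      refine ENNReal.tendsto_ofReal ?_
      have : Continuous fun τ : ℝ => 1 - 2 * τ := by fun_prop
      exact (this.tendsto 0).mono_left nhdsWithin_le_nhds
    exact ENNReal.Tendsto.sub tendsto_const_nhds (ENNReal.Tendsto.pow h1) (Or.inl (by simp))
  simp only [mul_zero, sub_zero, ENNReal.ofReal_one, one_pow, tsub_self] at ht
  obtain ⟨τ, h1, h2⟩ := ((ht.eventually_lt_const hη).and self_mem_nhdsWithin).exists
  refine ⟨τ, h2, ?_⟩
  have h2 : 0 < τ := h2
  have hsub : innerCube d k τ ⊆ unitCube d k := fun x hx p =>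
    ⟨h2.le.trans (hx p).1, (hx p).2.trans (by linarith)⟩
  rw [measure_sdiff hsub (measurableSet_innerCube d k τ).nullMeasurableSet
    ((measure_mono hsub).trans_lt (by rw [volume_unitCube]; simp)).ne, volume_unitCube,
    volume_innerCube]
  exact h1.le

variable {Ω : Type*}

lemma hist_add_eq_init_block (z : ℕ → Ω → Cube k) (d u : ℕ) (ω : Ω) :
    hist z d (d + u) ω = Fin.init (block z d u ω) := by
  funext j
  simp [hist, block, Fin.init]

lemma block_last (z : ℕ → Ω → Cube k) (d u : ℕ) (ω : Ω) :
    block z d u ω (Fin.last d) = z (d + u) ω := by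
  simp [block, add_comm]

variable [MeasurableSpace Ω]

lemma measurable_hist {z : ℕ → Ω → Cube k} (hz : ∀ i, Measurable (z i)) (d i : ℕ) :
    Measurable (hist z d i) := measurable_pi_lambda _ fun _ => hz _

/-- The law of the history at time `i`, on `ℝ^{kd}`. -/
def histLaw (μ : Measure Ω) (z : ℕ → Ω → Cube k) (d i : ℕ) : Measure (HistSpace d k) :=
  μ.map fun ω => toVec (hist z d i ω)

lemma measurable_toVec_hist {z : ℕ → Ω → Cube k} (hz : ∀ i, Measurable (z i)) (d i : ℕ) :
    Measurable fun ω => toVec (hist z d i ω) :=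
  continuous_toVec.measurable.comp (measurable_hist hz d i)

lemma histLaw_eq_inter {μ : Measure Ω} {z : ℕ → Ω → Cube k} (hz : ∀ i, Measurable (z i)) (d i : ℕ)
    {B : Set (HistSpace d k)} (hB : MeasurableSet B) :
    histLaw μ z d i B = μ {ω | toVec (hist z d i ω) ∈ B ∩ unitCube d k} := by
  rw [histLaw, Measure.map_apply (measurable_toVec_hist hz d i) hB]
  congr 1
  ext ω
  simp [toVec_mem_unitCube]

variable {μ : Measure Ω} {z : ℕ → Ω → Cube k} {D₀ D₁ : ℝ}

lemma HistComparable.histLaw_le (hc : HistComparable μ z d D₀ D₁) (hz : ∀ i, Measurable (z i))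
    {i : ℕ} (hi : d ≤ i) :
    histLaw μ z d i ≤ ENNReal.ofReal D₁ • volume.restrict (unitCube d k) := by
  refine Measure.le_iff.2 fun B hB => ?_
  rw [histLaw_eq_inter hz d i hB, Measure.smul_apply, Measure.restrict_apply hB]
  exact (hc i hi _ (hB.inter (measurableSet_unitCube d k)) fun x hx => hx.2).2

lemma HistComparable.le_histLaw (hc : HistComparable μ z d D₀ D₁) (hz : ∀ i, Measurable (z i))
    {i : ℕ} (hi : d ≤ i) :
    ENNReal.ofReal D₀ • volume.restrict (unitCube d k) ≤ histLaw μ z d i := by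
  refine Measure.le_iff.2 fun B hB => ?_
  rw [histLaw_eq_inter hz d i hB, Measure.smul_apply, Measure.restrict_apply hB]
  exact (hc i hi _ (hB.inter (measurableSet_unitCube d k)) fun x hx => hx.2).1

lemma HistComparable.measure_notMem_innerCube_le (hc : HistComparable μ z d D₀ D₁)
    {i : ℕ} (hi : d ≤ i) (τ : ℝ) :
    μ {ω | toVec (hist z d i ω) ∉ innerCube d k τ} ≤
      ENNReal.ofReal D₁ * volume (unitCube d k \ innerCube d k τ) := by
  refine le_trans (le_of_eq ?_) (hc i hi _ ((measurableSet_unitCube d k).diff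
    (measurableSet_innerCube d k τ)) fun x hx => hx.1).2
  congr 1
  ext ω
  simp [toVec_mem_unitCube]

variable {K : HistSpace d k → ℝ} {K₁ K₂ L γ : ℝ}

lemma IsSmoothingKernel.integrable_norm_mul (hK : IsSmoothingKernel K K₁ K₂ L γ) :
    Integrable fun v => ‖v‖ * K v := by
  have h : Integrable fun v : HistSpace d k => ∑ p, |v p * K v| :=
    integrable_finsetSum _ fun p _ => (hK.integrable_first p).abs
  refine h.mono' (continuous_norm.mul hK.continuous).aestronglyMeasurable (ae_of_all _ fun v => ?_)
  rw [Real.norm_eq_abs, abs_mul, abs_norm]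
  simp_rw [abs_mul]
  rw [← Finset.sum_mul]
  exact mul_le_mul_of_nonneg_right (norm_le_sum_abs v) (abs_nonneg _)

lemma integral_comp_inv_smul_sub_left (g : HistSpace d k → ℝ) {b : ℝ} (hb : 0 < b)
    (x : HistSpace d k) :
    ∫ y, g (b⁻¹ • (x - y)) = b ^ Module.finrank ℝ (HistSpace d k) * ∫ v, g v := by
  rw [integral_sub_left_eq_self (fun y => g (b⁻¹ • y)) volume x,
    Measure.integral_comp_inv_smul_of_nonneg _ _ hb.le, smul_eq_mul]

lemma integrable_comp_inv_smul_sub_left {g : HistSpace d k → ℝ} (hg : Integrable g) {b : ℝ}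
    (hb : 0 < b) (x : HistSpace d k) : Integrable fun y => g (b⁻¹ • (x - y)) :=
  (hg.comp_smul (inv_ne_zero hb.ne')).comp_sub_left x

/-- The kernel mass seen from `x` inside the cube dominates that of any set `O` which the
rescaling around `x` maps into the cube. -/
lemma IsSmoothingKernel.mul_setIntegral_le (hK : IsSmoothingKernel K K₁ K₂ L γ) {b : ℝ}
    (hb : 0 < b) {x : HistSpace d k} {O : Set (HistSpace d k)} (hO : MeasurableSet O)
    (hsub : ∀ v ∈ O, x - b • v ∈ unitCube d k) :
    b ^ Module.finrank ℝ (HistSpace d k) * ∫ v in O, K v ≤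
      ∫ y in unitCube d k, K (b⁻¹ • (x - y)) := by
  have h1 : ∫ v in O, K v = ∫ v, O.indicator K v := (integral_indicator hO).symm
  rw [h1, ← integral_comp_inv_smul_sub_left _ hb x, ← integral_indicator (measurableSet_unitCube d k)]
  refine integral_mono (integrable_comp_inv_smul_sub_left (hK.integrable.indicator hO) hb x)
    ((integrable_comp_inv_smul_sub_left hK.integrable hb x).indicator
      (measurableSet_unitCube d k)) fun y => ?_
  by_cases hy : b⁻¹ • (x - y) ∈ O
  · have : y ∈ unitCube d k := by
      have := hsub _ hy
      rwa [smul_inv_smul₀ hb.ne', sub_sub_cancel] at this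
    simp [hy, this]
  · simp only [Set.indicator_of_notMem hy]
    exact Set.indicator_nonneg (fun _ _ => hK.nonneg _) _

/-- Seen from the inner cube, almost all the kernel mass lies in the cube. -/
lemma IsSmoothingKernel.exists_lower_bound_innerCube (hK : IsSmoothingKernel K K₁ K₂ L γ) {τ : ℝ}
    (hτ : 0 < τ) :
    ∃ c b₁ : ℝ, 0 < c ∧ 0 < b₁ ∧ ∀ b, 0 < b → b ≤ b₁ → ∀ x ∈ innerCube d k τ,
      b ^ Module.finrank ℝ (HistSpace d k) * c ≤ ∫ y in unitCube d k, K (b⁻¹ • (x - y)) := by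
  set O : ℕ → Set (HistSpace d k) := fun n => Metric.closedBall 0 n with hO
  have hU : ⋃ n, O n = Set.univ := Metric.iUnion_closedBall_nat 0
  have ht := tendsto_setIntegral_of_monotone (μ := volume) (f := K) (s := O)
    (fun n => Metric.isClosed_closedBall.measurableSet)
    (fun m n h => Metric.closedBall_subset_closedBall (by exact_mod_cast h))
    hK.integrable.integrableOn
  rw [hU, setIntegral_univ, hK.integral_eq_one] at ht
  obtain ⟨n, hn⟩ := (ht.eventually_const_lt (show (1 / 2 : ℝ) < 1 by norm_num)).exists
  refine ⟨1 / 2, τ / (n + 1), by norm_num, by positivity, fun b hb hb₁ x hx => ?_⟩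
  refine le_trans ?_ (hK.mul_setIntegral_le hb (O := O n)
    Metric.isClosed_closedBall.measurableSet fun v hv p => ?_)
  · gcongr
  · have hv' : |v p| ≤ n :=
      (PiLp.norm_apply_le v p).trans (by simpa [hO] using hv)
    have h1 : |b * v p| ≤ τ := by
      rw [abs_mul, abs_of_pos hb]
      rw [le_div_iff₀ (by positivity)] at hb₁
      nlinarith
    rw [abs_le] at h1
    have := hx p
    simp only [PiLp.sub_apply, PiLp.smul_apply, smul_eq_mul]
    constructor <;> linarith [this.1, this.2]

/-- If the kernel charges all orthants, a fixed part of its mass lies in the cube, seen from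
any point of the cube. -/
lemma IsSmoothingKernel.exists_lower_bound_unitCube (hK : IsSmoothingKernel K K₁ K₂ L γ)
    (hch : ChargesOrthants K) :
    ∃ c b₁ : ℝ, 0 < c ∧ 0 < b₁ ∧ ∀ b, 0 < b → b ≤ b₁ → ∀ x ∈ unitCube d k,
      b ^ Module.finrank ℝ (HistSpace d k) * c ≤ ∫ y in unitCube d k, K (b⁻¹ • (x - y)) := by
  choose w hw1 hw2 hw3 using hch
  obtain ⟨r, hr⟩ : ∃ r : ℝ, ∀ A p, |w A p| < r := by
    obtain ⟨r, hr⟩ := (Set.finite_range fun q : Set (Fin d × Fin k) × (Fin d × Fin k) =>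
      |w q.1 q.2|).bddAbove
    exact ⟨r + 1, fun A p => lt_of_le_of_lt (hr ⟨(A, p), rfl⟩) (lt_add_one r)⟩
  have hr' : ∀ A p, -r < w A p ∧ w A p < r := fun A p => abs_lt.1 (hr A p)
  set O : Set (Fin d × Fin k) → Set (HistSpace d k) := fun A =>
    {v | ∀ p, (p ∈ A → v p ∈ Set.Ioo 0 r) ∧ (p ∉ A → v p ∈ Set.Ioo (-r) 0)} with hO
  have hOo : ∀ A, IsOpen (O A) := by
    intro A
    have e : O A = ⋂ p, {v : HistSpace d k | (p ∈ A → v p ∈ Set.Ioo 0 r) ∧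
        (p ∉ A → v p ∈ Set.Ioo (-r) 0)} := by
      ext v; simp [hO]
    rw [e]
    refine isOpen_iInter_of_finite fun p => ?_
    have hp : Continuous fun v : HistSpace d k => v p :=
      (EuclideanSpace.proj p : HistSpace d k →L[ℝ] ℝ).continuous
    by_cases hpA : p ∈ A
    · simp only [hpA, true_imp_iff, not_true, false_imp_iff, and_true]
      exact isOpen_Ioo.preimage hp
    · simp only [hpA, true_imp_iff, not_false_eq_true, false_imp_iff, true_and]
      exact isOpen_Ioo.preimage hp
  have hpos : ∀ A, 0 < ∫ v in O A, K v := by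
    intro A
    rw [setIntegral_pos_iff_support_of_nonneg_ae (ae_of_all _ hK.nonneg)
      hK.integrable.integrableOn]
    refine ((hK.continuous.isOpen_support).inter (hOo A)).measure_pos volume ⟨w A, (hw3 A).ne', ?_⟩
    exact fun p => ⟨fun hp => ⟨hw1 A p hp, (hr' A p).2⟩, fun hp => ⟨(hr' A p).1, hw2 A p hp⟩⟩
  obtain ⟨A₀, hA₀⟩ := Finite.exists_min fun A => ∫ v in O A, K v
  refine ⟨∫ v in O A₀, K v, 1 / (2 * (|r| + 1)), hpos A₀, by positivity, fun b hb hb₁ x hx => ?_⟩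
  -- The orthant is chosen so that each coordinate of `x - b • v` moves from `x` towards the farther
  -- face of the cube. The move is at most `b * r ≤ 1 / 2`, so it does not leave the cube.
  set A : Set (Fin d × Fin k) := {p | 1 / 2 ≤ x p} with hA
  refine le_trans ?_ (hK.mul_setIntegral_le hb (O := O A) (hOo A).measurableSet fun v hv p => ?_)
  · exact mul_le_mul_of_nonneg_left (hA₀ A) (by positivity)
  · have hbr : b * r ≤ 1 / 2 := by
      rw [le_div_iff₀ (by positivity)] at hb₁
      nlinarith [le_abs_self r]
    have hxp := hx p
    simp only [PiLp.sub_apply, PiLp.smul_apply, smul_eq_mul]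
    by_cases hp : p ∈ A
    · have h1 := (hv p).1 hp
      have h2 : 1 / 2 ≤ x p := hp
      constructor <;> nlinarith [h1.1, h1.2, hxp.1, hxp.2]
    · have h1 := (hv p).2 hp
      have h2 : x p < 1 / 2 := not_le.1 hp
      constructor <;> nlinarith [h1.1, h1.2, hxp.1, hxp.2]

variable [IsProbabilityMeasure μ] {H : Type*} {ℓ : H → Cube k → ℝ}

/-- The expected kernel weight at `x` is bounded below. -/
lemma HistComparable.le_integral_kernel (hc : HistComparable μ z d D₀ D₁)
    (hz : ∀ i, Measurable (z i)) (hD₀ : 0 < D₀) (hK : IsSmoothingKernel K K₁ K₂ L γ)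
    (b : ℝ) (x : HistSpace d k) :
    D₀ * ∫ y in unitCube d k, K (b⁻¹ • (x - y)) ≤
      ∫ ω, K (b⁻¹ • (x - toVec (hist z d d ω))) ∂μ := by
  have hcont : Continuous fun y => K (b⁻¹ • (x - y)) := by
    have := hK.continuous
    fun_prop
  have : IsProbabilityMeasure (histLaw μ z d d) :=
    Measure.isProbabilityMeasure_map (measurable_toVec_hist hz d d).aemeasurable
  have h := integral_mono_measure (hc.le_histLaw hz le_rfl)
    (ae_of_all _ fun y => hK.nonneg (b⁻¹ • (x - y)))
    (Integrable.of_mem_Icc 0 K₁ hcont.aemeasurable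
      (ae_of_all _ fun y => ⟨hK.nonneg _, hK.le_bound _⟩))
  rw [integral_smul_measure, ENNReal.toReal_ofReal hD₀.le, smul_eq_mul, histLaw,
    integral_map (measurable_toVec_hist hz d d).aemeasurable hcont.aestronglyMeasurable] at h
  exact h

/-- The bias of the kernel weighted loss. -/
lemma abs_integral_sub_mul_integral_le (hc : HistComparable μ z d D₀ D₁)
    (hz : ∀ i, Measurable (z i)) (hD₁ : 0 < D₁) (hK : IsSmoothingKernel K K₁ K₂ L γ)
    (hℓm : ∀ h, Measurable (ℓ h)) (hℓ : ∀ h y, ℓ h y ∈ Set.Icc (0 : ℝ) 1)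
    {R : H → (Fin d → Cube k) → ℝ} {L_R : ℝ} (hR : IsConditionalRisk μ z d ℓ R)
    (hRL : ∀ h x y, |R h x - R h y| ≤ L_R * ‖toVec x - toVec y‖) {b : ℝ} (hb : 0 < b) (h : H)
    (x : Fin d → Cube k) :
    |∫ ω, ℓ h (z d ω) * K (b⁻¹ • (toVec x - toVec (hist z d d ω))) ∂μ
      - R h x * ∫ ω, K (b⁻¹ • (toVec x - toVec (hist z d d ω))) ∂μ| ≤
    |L_R| * D₁ * (∫ v, ‖v‖ * K v) * b * b ^ Module.finrank ℝ (HistSpace d k) := by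
  have hmle : MeasurableSpace.comap (hist z d d) inferInstance ≤ ‹MeasurableSpace Ω› := (measurable_hist hz d d).comap_le
  set W : Ω → ℝ := fun ω => K (b⁻¹ • (toVec x - toVec (hist z d d ω))) with hW
  have hcont : Continuous fun y : Fin d → Cube k => K (b⁻¹ • (toVec x - toVec y)) := by
    have := hK.continuous
    have := continuous_toVec (d := d) (k := k)
    fun_prop
  have hWm : StronglyMeasurable[MeasurableSpace.comap (hist z d d) inferInstance] W :=
    (hcont.measurable.comp (comap_measurable (hist z d d))).stronglyMeasurable
  have hWI : ∀ ω, W ω ∈ Set.Icc 0 K₁ := fun ω => ⟨hK.nonneg _, hK.le_bound _⟩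
  have hWm' : Measurable W := hcont.measurable.comp (measurable_hist hz d d)
  have hWint : Integrable W μ := Integrable.of_mem_Icc 0 K₁ hWm'.aemeasurable (ae_of_all _ hWI)
  have hlm : Measurable fun ω => ℓ h (z d ω) := (hℓm h).comp (hz d)
  have hlint : Integrable (fun ω => ℓ h (z d ω)) μ :=
    Integrable.of_mem_Icc 0 1 hlm.aemeasurable (ae_of_all _ fun ω => hℓ h _)
  have hprod : Integrable ((fun ω => ℓ h (z d ω)) * W) μ :=
    Integrable.of_mem_Icc 0 K₁ (hlm.mul hWm').aemeasurable (ae_of_all _ fun ω =>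
      ⟨mul_nonneg (hℓ h _).1 (hWI ω).1,
        (mul_le_of_le_one_left (hWI ω).1 (hℓ h _).2).trans (hWI ω).2⟩)
  -- The kernel weight is a function of the history, hence can be taken out of the conditional
  -- expectation, where the loss turns into `R`.
  have hpull := condExp_mul_of_stronglyMeasurable_right hWm hprod hlint
  have hae : μ[(fun ω => ℓ h (z d ω)) * W | MeasurableSpace.comap (hist z d d) inferInstance]
      =ᵐ[μ] fun ω => R h (hist z d d ω) * W ω := by
    filter_upwards [hpull, hR h d le_rfl] with ω h1 h2
    rw [h1, Pi.mul_apply, h2]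
  have hRW : Integrable (fun ω => R h (hist z d d ω) * W ω) μ :=
    integrable_condExp.congr hae
  have hmean : ∫ ω, ℓ h (z d ω) * W ω ∂μ = ∫ ω, R h (hist z d d ω) * W ω ∂μ := by
    rw [← integral_congr_ae hae, integral_condExp hmle]
    rfl
  rw [hmean, ← integral_const_mul, ← integral_sub hRW (hWint.const_mul _)]
  set g : HistSpace d k → ℝ := fun v => ‖v‖ * K v with hg
  have hgint := hK.integrable_norm_mul
  have hgint' := integrable_comp_inv_smul_sub_left hgint hb (toVec x)
  have hg0 : ∀ v, 0 ≤ g v := fun v => mul_nonneg (norm_nonneg _) (hK.nonneg _)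
  have hle : histLaw μ z d d ≤ ENNReal.ofReal D₁ • volume :=
    (hc.histLaw_le hz le_rfl).trans (by gcongr; exact Measure.restrict_le_self)
  have hgvol : Integrable (fun y => g (b⁻¹ • (toVec x - y))) (ENNReal.ofReal D₁ • volume) :=
    hgint'.smul_measure (by simp)
  have hglaw := hgvol.mono_measure hle
  have hgμ : Integrable (fun ω => g (b⁻¹ • (toVec x - toVec (hist z d d ω)))) μ :=
    hglaw.comp_measurable (measurable_toVec_hist hz d d)
  -- The distance from `x` to the history is `b` times its rescaled value. This gives the factor `b`
  -- of the bias; the other factor `b ^ finrank` comes from the change of variables.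
  have hpt : ∀ ω, |R h (hist z d d ω) * W ω - R h x * W ω| ≤
      |L_R| * b * g (b⁻¹ • (toVec x - toVec (hist z d d ω))) := by
    intro ω
    rw [← sub_mul, abs_mul, abs_of_nonneg (hWI ω).1]
    simp only [hg, norm_smul, norm_inv, Real.norm_eq_abs, abs_of_pos hb]
    have h1 : |R h (hist z d d ω) - R h x| ≤ |L_R| * ‖toVec x - toVec (hist z d d ω)‖ := by
      refine (hRL h _ _).trans ?_
      rw [norm_sub_rev]
      gcongr
      exact le_abs_self _
    calc _ ≤ |L_R| * ‖toVec x - toVec (hist z d d ω)‖ * W ω := by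
          gcongr
          exact (hWI ω).1
      _ = _ := by simp only [hW]; field_simp
  calc _ ≤ ∫ ω, |R h (hist z d d ω) * W ω - R h x * W ω| ∂μ := abs_integral_le_integral_abs
    _ ≤ ∫ ω, |L_R| * b * g (b⁻¹ • (toVec x - toVec (hist z d d ω))) ∂μ :=
        integral_mono (hRW.sub (hWint.const_mul _)).abs (hgμ.const_mul _) hpt
    _ = |L_R| * b * ∫ y, g (b⁻¹ • (toVec x - y)) ∂(histLaw μ z d d) := by
        rw [integral_const_mul, histLaw,
          integral_map (measurable_toVec_hist hz d d).aemeasurable hglaw.aestronglyMeasurable]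
    _ ≤ |L_R| * b * ∫ y, g (b⁻¹ • (toVec x - y)) ∂(ENNReal.ofReal D₁ • volume) := by
        refine mul_le_mul_of_nonneg_left ?_ (by positivity)
        exact integral_mono_measure hle (ae_of_all _ fun y => hg0 _) hgvol
    _ = _ := by
        rw [integral_smul_measure, ENNReal.toReal_ofReal hD₁.le, smul_eq_mul,
          integral_comp_inv_smul_sub_left _ hb]
        ring

/-- A Lipschitz conditional risk is bounded. -/
lemma abs_conditionalRisk_le
    (hz : ∀ i, Measurable (z i)) (hℓm : ∀ h, Measurable (ℓ h))
    (hℓ : ∀ h y, ℓ h y ∈ Set.Icc (0 : ℝ) 1)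
    {R : H → (Fin d → Cube k) → ℝ} {L_R : ℝ} (hR : IsConditionalRisk μ z d ℓ R)
    (hRL : ∀ h x y, |R h x - R h y| ≤ L_R * ‖toVec x - toVec y‖) (h : H) (x : Fin d → Cube k) :
    |R h x| ≤ 1 + |L_R| * Fintype.card (Fin d × Fin k) := by
  have hlint : Integrable (fun ω => ℓ h (z d ω)) μ :=
    Integrable.of_mem_Icc 0 1 ((hℓm h).comp (hz d)).aemeasurable (ae_of_all _ fun ω => hℓ h _)
  -- Only almost everywhere is `R` tied to the loss; one good history suffices, as the Lipschitz
  -- bound and the diameter of the cube cover the others.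
  have h1 : ∀ᵐ ω ∂μ, |R h (hist z d d ω)| ≤ 1 := by
    have hb := ae_bdd_abs_condExp_of_ae_bdd_abs (m := MeasurableSpace.comap (hist z d d) inferInstance)
      (μ := μ) (R := 1) (f := fun ω => ℓ h (z d ω)) (ae_of_all _ fun ω => by
        rw [abs_of_nonneg (hℓ h _).1]; exact (hℓ h _).2)
    filter_upwards [hb, hR h d le_rfl] with ω h1 h2
    rw [← h2]; exact h1
  obtain ⟨ω, hω⟩ := h1.exists
  have h2 : |R h x - R h (hist z d d ω)| ≤ |L_R| * Fintype.card (Fin d × Fin k) := by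
    refine (hRL h _ _).trans ?_
    gcongr
    · exact le_abs_self _
    · exact norm_toVec_sub_toVec_le _ _
  have h3 := abs_sub_abs_le_abs_sub (R h x) (R h (hist z d d ω))
  linarith

end Bias

/-! ### From deviations and bias to the ratio estimator. -/

section Deviation

variable {k d : ℕ} {Ω H : Type*} {z : ℕ → Ω → Cube k} {ℓ : H → Cube k → ℝ} {K : HistSpace d k → ℝ} {K₁ K₂ L γ : ℝ}

lemma kernelLoss_block (K : HistSpace d k → ℝ) (ℓ : H → Cube k → ℝ) (z : ℕ → Ω → Cube k)
    (b : ℝ) (h : H) (x : HistSpace d k) (u : ℕ) (ω : Ω) :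
    kernelLoss K ℓ b h x (block z d u ω)
      = ℓ h (z (d + u) ω) * K (b⁻¹ • (x - toVec (hist z d (d + u) ω))) := by
  rw [kernelLoss, block_last, hist_add_eq_init_block]

/-- The constant loss `1`, as a class. -/
def oneLoss (k : ℕ) (_ : PUnit) (_ : Cube k) : ℝ := 1

/-- The common prefactor cancels, so the power of `b` in it is immaterial. The denominator becomes
the kernel sum of the constant loss. -/
lemma riskEst_eq_div (K : HistSpace d k → ℝ) (ℓ : H → Cube k → ℝ) (z : ℕ → Ω → Cube k) {b : ℝ}
    (hb : 0 < b) {N : ℕ} (hN : d < N) (h : H) (x : Fin d → Cube k) (ω : Ω) :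
    riskEst K ℓ z b N h x ω =
      (∑ u ∈ Finset.range (N - d), kernelLoss K ℓ b h (toVec x) (block z d u ω)) /
      ∑ u ∈ Finset.range (N - d), kernelLoss K (oneLoss k) b ⟨⟩ (toVec x) (block z d u ω) := by
  have hpre : 1 / (((Finset.Ico d N).card : ℝ) * b ^ d) ≠ 0 := by
    have : 0 < ((Finset.Ico d N).card : ℝ) := by simpa using hN
    positivity
  simp_rw [kernelLoss_block]
  rw [riskEst, numerEst, denomEst, mul_div_mul_left _ _ hpre, Finset.sum_Ico_eq_sum_range,
    Finset.sum_Ico_eq_sum_range]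
  simp [oneLoss]

lemma uniformDeviation_le_of_forall {R : H → (Fin d → Cube k) → ℝ} {b ε : ℝ} {N : ℕ} {ω : Ω}
    (h : ∀ h, |R h (hist z d N ω) - riskEst K ℓ z b N h (hist z d N ω) ω| ≤ ε) :
    uniformDeviation K ℓ R z b N ω ≤ ENNReal.ofReal ε :=
  iSup_le fun i => ENNReal.ofReal_le_ofReal (h i)

variable [MeasurableSpace Ω] {μ : Measure Ω}

lemma integral_kernelLoss (hK : IsSmoothingKernel K K₁ K₂ L γ) (hz : ∀ i, Measurable (z i))
    (hℓm : ∀ h, Measurable (ℓ h)) (b : ℝ) (h : H) (x : HistSpace d k) :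
    ∫ s, kernelLoss K ℓ b h x s ∂(μ.map (block z d 0))
      = ∫ ω, ℓ h (z d ω) * K (b⁻¹ • (x - toVec (hist z d d ω))) ∂μ := by
  rw [integral_map (measurable_block hz d 0).aemeasurable
    (measurable_kernelLoss hK hℓm b h x).aestronglyMeasurable]
  exact integral_congr_ae (ae_of_all _ fun ω => kernelLoss_block K ℓ z b h x 0 ω)

/-- The event that some kernel weighted sum deviates by more than `τ` per term. -/
def deviationEvent (μ : Measure Ω) (z : ℕ → Ω → Cube k) (K : HistSpace d k → ℝ)
    (ℓ : H → Cube k → ℝ) (b τ : ℝ) (N : ℕ) : Set Ω :=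
  {ω | ∃ h x, τ * N < |∑ u ∈ Finset.range N, (kernelLoss K ℓ b h x (block z d u ω)
          - ∫ s, kernelLoss K ℓ b h x s ∂(μ.map (block z d 0)))|}

lemma abs_sum_sub_le_of_notMem_deviationEvent {b τ : ℝ} {N : ℕ} {ω : Ω}
    (hω : ω ∉ deviationEvent μ z K ℓ b τ N) (h : H) (x : HistSpace d k) :
    |∑ u ∈ Finset.range N, kernelLoss K ℓ b h x (block z d u ω)
      - N * ∫ s, kernelLoss K ℓ b h x s ∂(μ.map (block z d 0))| ≤ τ * N := by
  have : ¬ ∃ h x, τ * N < |∑ u ∈ Finset.range N, (kernelLoss K ℓ b h x (block z d u ω)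
          - ∫ s, kernelLoss K ℓ b h x s ∂(μ.map (block z d 0)))| := hω
  push Not at this
  have := this h x
  rwa [Finset.sum_sub_distrib, Finset.sum_const, nsmul_eq_mul, Finset.card_range] at this

/-- A ratio of sums is close to `r` when both sums are close to their means and the means have a
ratio close to `r`. -/
lemma abs_sub_div_le_of_close {S T E₁ E₀ n r s κ a ρ : ℝ} (hn : 0 < n) (hs : 0 < s)
    (hS : |S - n * E₁| ≤ κ * s * n) (hT : |T - n * E₀| ≤ κ * s * n)
    (hE : |E₁ - r * E₀| ≤ ρ * s) (hE₀ : s * a ≤ E₀) (hκ : κ < a) {C : ℝ} (hr : |r| ≤ C) :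
    |r - S / T| ≤ (κ * (1 + C) + ρ) / (a - κ) := by
  have ha : 0 < a - κ := sub_pos.2 hκ
  have hTlow : n * s * (a - κ) ≤ T := by
    have h1 := (abs_le.1 hT).1
    nlinarith
  have hTpos : 0 < T := lt_of_lt_of_le (by positivity) hTlow
  have hκ0 : 0 ≤ κ * s * n := (abs_nonneg _).trans hS
  have hnum : |r * T - S| ≤ n * s * (κ * (1 + C) + ρ) := by
    -- The three terms are the deviation of the denominator, that of the numerator, and the bias.
    have e : r * T - S = r * (T - n * E₀) - (S - n * E₁) - n * (E₁ - r * E₀) := by ring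
    rw [e]
    have h1 : |r * (T - n * E₀)| ≤ C * (κ * s * n) := by
      rw [abs_mul]
      exact mul_le_mul hr hT (abs_nonneg _) ((abs_nonneg _).trans hr)
    have h2 : |n * (E₁ - r * E₀)| ≤ n * (ρ * s) := by
      rw [abs_mul, abs_of_pos hn]
      gcongr
    have h3 := abs_sub (r * (T - n * E₀) - (S - n * E₁)) (n * (E₁ - r * E₀))
    have h4 := abs_sub (r * (T - n * E₀)) (S - n * E₁)
    linarith
  have e : r - S / T = (r * T - S) / T := by field_simp
  rw [e, abs_div, abs_of_pos hTpos, div_le_div_iff₀ hTpos ha]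
  have hB : 0 ≤ κ * (1 + C) + ρ := by
    have h := (abs_nonneg _).trans hnum
    exact nonneg_of_mul_nonneg_right h (by positivity)
  calc |r * T - S| * (a - κ) ≤ n * s * (κ * (1 + C) + ρ) * (a - κ) := by gcongr
    _ = (κ * (1 + C) + ρ) * (n * s * (a - κ)) := by ring
    _ ≤ _ := by gcongr

variable [IsProbabilityMeasure μ]

/-- Off the deviation events the estimator is close to the conditional risk, at every history from
which the kernel sees enough of the cube. -/
lemma abs_sub_riskEst_le {D₀ D₁ : ℝ} (hc : HistComparable μ z d D₀ D₁)
    (hz : ∀ i, Measurable (z i)) (hD₀ : 0 < D₀) (hD₁ : 0 < D₁)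
    (hK : IsSmoothingKernel K K₁ K₂ L γ)
    (hℓm : ∀ h, Measurable (ℓ h)) (hℓ : ∀ h y, ℓ h y ∈ Set.Icc (0 : ℝ) 1)
    {R : H → (Fin d → Cube k) → ℝ} {L_R : ℝ} (hR : IsConditionalRisk μ z d ℓ R)
    (hRL : ∀ h x y, |R h x - R h y| ≤ L_R * ‖toVec x - toVec y‖) {b : ℝ} (hb : 0 < b)
    {N : ℕ} (hN : d < N) {ω : Ω} {c τ η : ℝ} {x : Fin d → Cube k}
    (hτ : τ ≤ η * b ^ Module.finrank ℝ (HistSpace d k))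
    (h₁ : ω ∉ deviationEvent μ z K ℓ b τ (N - d))
    (h₀ : ω ∉ deviationEvent μ z K (oneLoss k) b τ (N - d))
    (hx : b ^ Module.finrank ℝ (HistSpace d k) * c ≤
      ∫ y in unitCube d k, K (b⁻¹ • (toVec x - y))) (hη : η < D₀ * c) (h : H) :
    |R h x - riskEst K ℓ z b N h x ω| ≤
      (η * (1 + (1 + |L_R| * Fintype.card (Fin d × Fin k)))
        + |L_R| * D₁ * (∫ v, ‖v‖ * K v) * b) / (D₀ * c - η) := by
  have hn : (0 : ℝ) < (N - d : ℕ) := by exact_mod_cast Nat.sub_pos_of_lt hN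
  have hs : 0 < b ^ Module.finrank ℝ (HistSpace d k) := by positivity
  rw [riskEst_eq_div K ℓ z hb hN]
  have e₁ := integral_kernelLoss (μ := μ) hK hz hℓm b h (toVec x)
  have e₀ := integral_kernelLoss (μ := μ) (ℓ := oneLoss k) hK hz
    (fun _ => measurable_const) b ⟨⟩ (toVec x)
  simp only [oneLoss, one_mul] at e₀
  refine abs_sub_div_le_of_close hn hs
    ((abs_sum_sub_le_of_notMem_deviationEvent h₁ h (toVec x)).trans (by gcongr))
    ((abs_sum_sub_le_of_notMem_deviationEvent h₀ ⟨⟩ (toVec x)).trans (by gcongr)) ?_ ?_ hη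
    (abs_conditionalRisk_le hz hℓm hℓ hR hRL h x)
  · rw [e₁, e₀]
    exact abs_integral_sub_mul_integral_le hc hz hD₁ hK hℓm hℓ hR hRL hb h x
  · rw [e₀]
    refine le_trans ?_ (hc.le_integral_kernel hz hD₀ hK b (toVec x))
    calc _ = D₀ * (b ^ Module.finrank ℝ (HistSpace d k) * c) := by ring
      _ ≤ _ := by gcongr

/-- The deterministic part of the consistency: with bandwidths and tolerances tending to zero, the
uniform deviation is eventually small off the deviation events. -/
lemma eventually_uniformDeviation_le {D₀ D₁ : ℝ} (hc : HistComparable μ z d D₀ D₁)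
    (hz : ∀ i, Measurable (z i)) (hD₀ : 0 < D₀) (hD₁ : 0 < D₁)
    (hK : IsSmoothingKernel K K₁ K₂ L γ)
    (hℓm : ∀ h, Measurable (ℓ h)) (hℓ : ∀ h y, ℓ h y ∈ Set.Icc (0 : ℝ) 1)
    {R : H → (Fin d → Cube k) → ℝ} {L_R : ℝ} (hR : IsConditionalRisk μ z d ℓ R)
    (hRL : ∀ h x y, |R h x - R h y| ≤ L_R * ‖toVec x - toVec y‖)
    {b η τ : ℕ → ℝ} (hb : ∀ N, 0 < b N) (hb₀ : Tendsto b atTop (𝓝 0))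
    (hη : Tendsto η atTop (𝓝 0))
    (hτ : ∀ᶠ N in atTop, τ N ≤ η N * b N ^ Module.finrank ℝ (HistSpace d k))
    {X : Set (HistSpace d k)} {c b₁ : ℝ} (hc₀ : 0 < c) (hb₁ : 0 < b₁)
    (hX : ∀ b, 0 < b → b ≤ b₁ → ∀ x ∈ X,
      b ^ Module.finrank ℝ (HistSpace d k) * c ≤ ∫ y in unitCube d k, K (b⁻¹ • (x - y)))
    {ε : ℝ} (hε : 0 < ε) :
    ∀ᶠ N in atTop, ∀ ω, ω ∉ deviationEvent μ z K ℓ (b N) (τ N) (N - d) →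
      ω ∉ deviationEvent μ z K (oneLoss k) (b N) (τ N) (N - d) →
      toVec (hist z d N ω) ∈ X → uniformDeviation K ℓ R z (b N) N ω ≤ ENNReal.ofReal ε := by
  have ht : Tendsto (fun N => (η N * (1 + (1 + |L_R| * Fintype.card (Fin d × Fin k)))
      + |L_R| * D₁ * (∫ v, ‖v‖ * K v) * b N) / (D₀ * c - η N)) atTop (𝓝 0) := by
    have h1 := ((hη.mul_const (1 + (1 + |L_R| * (Fintype.card (Fin d × Fin k) : ℝ)))).add
      (hb₀.const_mul (|L_R| * D₁ * (∫ v, ‖v‖ * K v)))).div (hη.const_sub (D₀ * c))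
      (by simpa using ⟨hD₀.ne', hc₀.ne'⟩)
    simp only [zero_mul, mul_zero, add_zero, zero_div] at h1
    exact h1
  have hηc : ∀ᶠ N in atTop, η N < D₀ * c := hη.eventually_lt_const (by positivity)
  filter_upwards [ht.eventually_lt_const hε, hηc, hb₀.eventually_lt_const hb₁, hτ,
    eventually_gt_atTop d] with N h1 h2 h3 h4 h5 ω hω₁ hω₀ hωX
  exact uniformDeviation_le_of_forall fun h =>
    (abs_sub_riskEst_le hc hz hD₀ hD₁ hK hℓm hℓ hR hRL (hb N) h5 h4 hω₁ hω₀
      (hX (b N) (hb N) h3.le _ hωX) h2 h).trans h1.le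

end Deviation

/-! ### Slowly growing sequences and summable rates. -/

section Rates

/-- Diagonal argument: `g N` is the largest `m ≤ N` whose threshold `T m` has been passed. It tends
to infinity because every threshold is passed eventually. -/
lemma exists_tendsto_atTop_eventually {P : ℕ → ℕ → Prop} (hP : ∀ m, ∀ᶠ N in atTop, P m N) :
    ∃ g : ℕ → ℕ, Tendsto g atTop atTop ∧ ∀ᶠ N in atTop, P (g N) N := by
  classical
  choose T hT using fun m => eventually_atTop.1 (hP m)
  refine ⟨fun N => Nat.findGreatest (fun m => T m ≤ N) N, tendsto_atTop.2 fun m => ?_, ?_⟩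
  · filter_upwards [eventually_ge_atTop m, eventually_ge_atTop (T m)] with N h1 h2
    exact Nat.le_findGreatest h1 h2
  · filter_upwards [eventually_ge_atTop (T 0)] with N hN
    exact hT _ N (Nat.findGreatest_spec (P := fun m => T m ≤ N) (Nat.zero_le N) hN)

/-- Block numbers that grow so slowly that a given mixing rate suffices. -/
lemma exists_blockNumber (d : ℕ) {β : ℕ → ℝ} (hβ : Tendsto β atTop (𝓝 0)) :
    ∃ n : ℕ → ℕ, Tendsto n atTop atTop ∧ ∀ᶠ N in atTop, n N ^ 2 + d ≤ N ∧
      (n N : ℝ≥0∞) ^ 2 * ENNReal.ofReal (β ((N - d) / n N - d))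
        ≤ ENNReal.ofReal (1 / ((n N : ℝ) + 1)) := by
  refine exists_tendsto_atTop_eventually (P := fun n N => n ^ 2 + d ≤ N ∧
    (n : ℝ≥0∞) ^ 2 * ENNReal.ofReal (β ((N - d) / n - d)) ≤ ENNReal.ofReal (1 / ((n : ℝ) + 1)))
    fun n => ?_
  refine (eventually_ge_atTop (n ^ 2 + d)).and ?_
  rcases Nat.eq_zero_or_pos n with rfl | hn
  · simp
  -- For a fixed number `n` of blocks the gap tends to infinity with `N`, so `n²` times the mixing
  -- term vanishes without any rate.
  have h1 : Tendsto (fun N => (N - d) / n - d) atTop atTop :=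
    (tendsto_sub_atTop_nat d).comp
      ((Nat.tendsto_div_const_atTop hn.ne').comp (tendsto_sub_atTop_nat d))
  have h2 : Tendsto (fun N => (n : ℝ≥0∞) ^ 2 * ENNReal.ofReal (β ((N - d) / n - d))) atTop
      (𝓝 ((n : ℝ≥0∞) ^ 2 * ENNReal.ofReal 0)) :=
    ENNReal.Tendsto.const_mul (ENNReal.tendsto_ofReal (hβ.comp h1)) (Or.inr (by finiteness))
  rw [ENNReal.ofReal_zero, mul_zero] at h2
  exact (h2.eventually_lt_const (ENNReal.ofReal_pos.2 (by positivity))).mono fun N h => h.le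

/-- With `n = √(N - d)` blocks the spacing is at least `n`, and exponential mixing beats `n ^ 6`.
Both terms are then at most `n ^ (-4)`, and `N - d ≤ (2n)²` turns `4 / n ^ 4` into the summable `64
/ (N - d)²`. -/
lemma eventually_sqrt_mixing_bound_le (d : ℕ) {c₁ c₂ : ℝ} (hc₁ : 0 < c₁) (hc₂ : 0 < c₂) :
    ∀ᶠ N : ℕ in atTop,
      2 * (ENNReal.ofReal (1 / (Nat.sqrt (N - d) : ℝ) ^ 4) + (Nat.sqrt (N - d) : ℝ≥0∞) ^ 2 *
        ENNReal.ofReal (c₁ * Real.exp (-c₂ * ((N - d) / Nat.sqrt (N - d) - d : ℕ))))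
      ≤ ENNReal.ofReal (64 / ((N - d : ℕ) : ℝ) ^ 2) := by
  have h4 : Tendsto (fun n : ℕ => (c₁ * Real.exp (c₂ * d)) *
      ((n : ℝ) ^ 6 * Real.exp (-c₂ * n))) atTop (𝓝 0) := by
    have := (Real.tendsto_pow_mul_exp_neg_atTop_nhds_zero 6).comp
      ((tendsto_natCast_atTop_atTop (R := ℝ)).const_mul_atTop hc₂)
    have := this.const_mul ((c₁ * Real.exp (c₂ * d)) / c₂ ^ 6)
    rw [mul_zero] at this
    refine this.congr fun n => ?_
    simp only [Function.comp_apply]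
    rw [mul_pow]
    field_simp
  have hsq : Tendsto (fun N : ℕ => Nat.sqrt (N - d)) atTop atTop := by
    refine tendsto_atTop.2 fun m => ?_
    filter_upwards [eventually_ge_atTop (m ^ 2 + d)] with N hN
    exact Nat.le_sqrt'.2 (by omega)
  filter_upwards [hsq.eventually (h4.eventually_lt_const zero_lt_one),
    hsq.eventually (eventually_gt_atTop 0)] with N h1 hn
  set n := Nat.sqrt (N - d) with hn'
  have hnr : (1 : ℝ) ≤ n := by exact_mod_cast hn
  have hle : n ^ 2 ≤ N - d := Nat.sqrt_le' _
  have hlt : N - d < (n + 1) ^ 2 := Nat.lt_succ_sqrt' _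
  have hdiv : n ≤ (N - d) / n := (Nat.le_div_iff_mul_le hn).2 (by nlinarith)
  have hexp : (n : ℝ) ^ 2 * (c₁ * Real.exp (-c₂ * ((N - d) / n - d : ℕ))) ≤ 1 / (n : ℝ) ^ 4 := by
    rw [le_div_iff₀ (by positivity)]
    have hcast : (n : ℝ) - d ≤ ((N - d) / n - d : ℕ) := by
      have : n ≤ ((N - d) / n - d) + d := by omega
      have : (n : ℝ) ≤ ((N - d) / n - d : ℕ) + d := by exact_mod_cast this
      linarith
    calc _ ≤ (n : ℝ) ^ 2 * (c₁ * Real.exp (-c₂ * (n - d))) * (n : ℝ) ^ 4 := by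
          gcongr _ * (_ * Real.exp ?_) * _
          nlinarith
      _ = c₁ * Real.exp (c₂ * d) * ((n : ℝ) ^ 6 * Real.exp (-c₂ * n)) := by
          have : -c₂ * ((n : ℝ) - d) = c₂ * d + -c₂ * n := by ring
          rw [this, Real.exp_add]
          ring
      _ ≤ 1 := h1.le
  have hpos : (0 : ℝ) < (N - d : ℕ) := by
    have : 0 < N - d := lt_of_lt_of_le (by positivity) hle
    exact_mod_cast this
  have hfin : 4 * (1 / (n : ℝ) ^ 4) ≤ 64 / ((N - d : ℕ) : ℝ) ^ 2 := by
    rw [mul_one_div, div_le_div_iff₀ (by positivity) (by positivity)]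
    have h2 : ((N - d : ℕ) : ℝ) ≤ (2 * n) ^ 2 := by
      have : ((N - d : ℕ) : ℝ) ≤ ((n : ℝ) + 1) ^ 2 := by exact_mod_cast hlt.le
      nlinarith
    calc (4 : ℝ) * ((N - d : ℕ) : ℝ) ^ 2 ≤ 4 * ((2 * n) ^ 2) ^ 2 := by gcongr
      _ = 64 * (n : ℝ) ^ 4 := by ring
  rw [← ENNReal.ofReal_natCast n, ← ENNReal.ofReal_pow (by positivity),
    ← ENNReal.ofReal_mul (by positivity), ← ENNReal.ofReal_add (by positivity) (by positivity),
    ← ENNReal.ofReal_ofNat 2, ← ENNReal.ofReal_mul (by norm_num)]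
  refine ENNReal.ofReal_le_ofReal (le_trans ?_ hfin)
  linarith

lemma tsum_ofReal_div_sq_ne_top (C : ℝ) (d : ℕ) {N₀ : ℕ} (hN₀ : d < N₀) :
    ∑' i : ℕ, ENNReal.ofReal (C / ((i + N₀ - d : ℕ) : ℝ) ^ 2) ≠ ⊤ := by
  refine Summable.tsum_ofReal_ne_top ?_
  have h : Summable fun i : ℕ => C / (i : ℝ) ^ 2 := by
    simpa [div_eq_mul_inv] using (Real.summable_one_div_nat_pow.2 one_lt_two).mul_left C
  have h' := (summable_nat_add_iff (N₀ - d)).2 h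
  refine h'.congr fun i => ?_
  rw [Nat.add_sub_assoc hN₀.le]

end Rates

/-! ### The bandwidth threshold. -/

section Consistency

lemma isMeasurableClass_oneLoss (k : ℕ) : IsMeasurableClass (oneLoss k) := by
  intro m w ν _
  simp only [oneLoss]
  exact aemeasurable_const

lemma maxCoveringNumber_oneLoss_le (k : ℕ) {θ : ℝ} (hθ : 0 < θ) (n : ℕ) {M : ℕ} (hM : 1 ≤ M) :
    maxCoveringNumber θ (Set.range (oneLoss k)) n ≤ M := by
  refine iSup_le fun x => coveringNumber_le_of_isCover (V := {fun _ => 1}) ?_ (by simpa using hM)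
  rintro _ ⟨_, rfl⟩
  exact ⟨fun _ => 1, by simp, by simpa [oneLoss] using hθ.le⟩

/-- Raising the bound to at least `1` makes it valid for the constant loss too, so one threshold
serves numerator and denominator. -/
lemma maxCoveringNumber_le_max_one {k : ℕ} {H : Type*} {ℓ : H → Cube k → ℝ} {cov : ℝ → ℕ → ℕ}
    (h : ∀ θ : ℝ, 0 < θ → ∀ n : ℕ, maxCoveringNumber θ (Set.range ℓ) n ≤ (cov θ n : ℕ∞))
    (θ : ℝ) (hθ : 0 < θ) (n : ℕ) :
    maxCoveringNumber θ (Set.range ℓ) n ≤ (max (cov θ n) 1 : ℕ) :=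
  (h θ hθ n).trans (by exact_mod_cast le_max_left _ _)

/-- A threshold for the bandwidth. Above it, and with at least `n₁ N` blocks, the deviation events are
unlikely, at a tolerance that is small with respect to the kernel mass. -/
theorem exists_bandwidth {k d : ℕ} {K : HistSpace d k → ℝ} {K₁ K₂ L γ : ℝ}
    (hK : IsSmoothingKernel K K₁ K₂ L γ) (cov : ℝ → ℕ → ℕ)
    (hcov : ∀ θ : ℝ, 0 < θ → Tendsto (fun n : ℕ => Real.log (cov θ n : ℝ) / (n : ℝ)) atTop (𝓝 0))
    {n₁ : ℕ → ℕ} (hn₁ : Tendsto n₁ atTop atTop) :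
    ∃ b₀ : ℕ → ℝ, (∀ N, 0 < b₀ N) ∧ Tendsto b₀ atTop (𝓝 0) ∧
      ∀ᶠ N in atTop, ∀ n, n₁ N ≤ n → n ^ 2 ≤ N - d →
      ∀ (Ω : Type*) [MeasurableSpace Ω] (μ : Measure Ω) [IsProbabilityMeasure μ]
        (z : ℕ → Ω → Cube k), (∀ i, Measurable (z i)) → IsStationary μ z →
      ∀ (H : Type*) (ℓ : H → Cube k → ℝ), (∀ h, Measurable (ℓ h)) →
        (∀ h y, ℓ h y ∈ Set.Icc (0 : ℝ) 1) → IsMeasurableClass ℓ →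
        (∀ θ : ℝ, 0 < θ → ∀ n : ℕ,
          maxCoveringNumber θ (Set.range ℓ) n ≤ (max (cov θ n) 1 : ℕ)) →
      ∀ b, b₀ N ≤ b →
        μ (deviationEvent μ z K ℓ b (b₀ N ^ (Module.finrank ℝ (HistSpace d k) + 1)) (N - d)) ≤
        ENNReal.ofReal (1 / (n : ℝ) ^ 4) + (n : ℝ≥0∞) ^ 2 * betaCoeff μ z ((N - d) / n - d) := by
  have hpos : ∀ m : ℕ, (0 : ℝ) < 1 / ((m : ℝ) + 1) := fun m => by positivity
  -- Stage `m` has minimal bandwidth `1 / (m + 1)` and tolerance its power of order `finrank + 1`: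
  -- smaller by a factor `1 / (m + 1)` than the kernel mass scale at that bandwidth.
  choose Φ hΦ using fun m : ℕ => exists_sampleSize hK cov hcov
    (pow_pos (hpos m) (Module.finrank ℝ (HistSpace d k) + 1)) (hpos m)
  obtain ⟨m, hm, hmΦ⟩ := exists_tendsto_atTop_eventually (P := fun m N => Φ m ≤ n₁ N)
    fun m => hn₁.eventually_ge_atTop (Φ m)
  refine ⟨fun N => 1 / ((m N : ℝ) + 1), fun N => hpos _,
    tendsto_one_div_add_atTop_nhds_zero_nat.comp hm, ?_⟩
  filter_upwards [hmΦ] with N hN n hn hnN Ω _ μ _ z hz hst H ℓ hℓm hℓ hmeas hcovℓ b hb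
  exact hΦ (m N) n (hN.trans hn) (N - d) hnN Ω μ z hz hst H ℓ hℓm hℓ hmeas hcovℓ b hb

lemma tendsto_zero_of_forall_eventually_le {u : ℕ → ℝ≥0∞}
    (h : ∀ ε : ℝ, 0 < ε → ∀ᶠ N in atTop, u N ≤ ENNReal.ofReal ε) : Tendsto u atTop (𝓝 0) := by
  rw [ENNReal.tendsto_nhds_zero]
  intro ε hε
  obtain ⟨r, hr, hrε⟩ := ENNReal.lt_iff_exists_nnreal_btwn.1 hε
  filter_upwards [h r (by exact_mod_cast hr)] with N hN
  rw [ENNReal.ofReal_coe_nnreal] at hN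
  exact hN.trans hrε.le

end Consistency

end CondRisk

end

/-! ### Both modes of convergence. -/

theorem theorem1
    (k d : ℕ) (hk : 0 < k) (hd : 0 < d)
    -- the smoothing kernel
    (K : CondRisk.HistSpace d k → ℝ) (K₁ K₂ L γ : ℝ)
    (hK : CondRisk.IsSmoothingKernel K K₁ K₂ L γ)
    -- a bound for the covering numbers of the loss class, subexponential in the sample size
    (cov : ℝ → ℕ → ℕ)
    (hcov : ∀ θ : ℝ, 0 < θ → Tendsto (fun n : ℕ => Real.log (cov θ n : ℝ) / (n : ℝ)) atTop (𝓝 0))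
    -- a mixing rate
    (β : ℕ → ℝ) (hβ : Tendsto β atTop (𝓝 0)) :
    -- the threshold for the bandwidth, which itself tends to zero, depends only on the data above
    ∃ b₀ : ℕ → ℝ, (∀ N, 0 < b₀ N) ∧ Tendsto b₀ atTop (𝓝 0) ∧
      ∀ (Ω : Type*) [MeasurableSpace Ω] (μ : Measure Ω) [IsProbabilityMeasure μ]
        (z : ℕ → Ω → CondRisk.Cube k),
        (∀ i, Measurable (z i)) → CondRisk.IsStationary μ z →
        (∀ j, CondRisk.betaCoeff μ z j ≤ ENNReal.ofReal (β j)) →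
      ∀ (H : Type*) (ℓ : H → CondRisk.Cube k → ℝ),
        (∀ h, Measurable (ℓ h)) → (∀ h y, ℓ h y ∈ Set.Icc (0 : ℝ) 1) →
        CondRisk.IsMeasurableClass ℓ →
        (∀ θ : ℝ, 0 < θ → ∀ n : ℕ,
          CondRisk.maxCoveringNumber θ (Set.range ℓ) n ≤ (cov θ n : ℕ∞)) →
      ∀ D₀ D₁ : ℝ, 0 < D₀ → 0 < D₁ → CondRisk.HistComparable μ z d D₀ D₁ →
      ∀ (R : H → (Fin d → CondRisk.Cube k) → ℝ) (L_R : ℝ),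
        CondRisk.IsConditionalRisk μ z d ℓ R →
        (∀ h x y, |R h x - R h y| ≤ L_R * ‖CondRisk.toVec x - CondRisk.toVec y‖) →
      ∀ b : ℕ → ℝ, (∀ N, 0 < b N) → Tendsto b atTop (𝓝 0) → (∀ᶠ N in atTop, b₀ N ≤ b N) →
        -- convergence in probability
        (∀ ε : ℝ, 0 < ε → Tendsto
          (fun N => μ {ω | ENNReal.ofReal ε ≤ CondRisk.uniformDeviation K ℓ R z (b N) N ω})
          atTop (𝓝 0)) ∧
        -- almost sure convergence in the exponentially mixing case
        (CondRisk.IsExpBetaMixing μ z → CondRisk.ChargesOrthants K →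
          ∀ᵐ ω ∂μ, Tendsto (fun N => CondRisk.uniformDeviation K ℓ R z (b N) N ω) atTop (𝓝 0)) := by
  obtain ⟨n₁, hn₁, hn₁β⟩ := CondRisk.exists_blockNumber d hβ
  obtain ⟨b₀, hb₀pos, hb₀, hbound⟩ := CondRisk.exists_bandwidth hK cov hcov hn₁
  refine ⟨b₀, hb₀pos, hb₀, ?_⟩
  intro Ω _ μ _ z hz hst hmix H ℓ hℓm hℓ hmeas hcovℓ D₀ D₁ hD₀ hD₁ hcomp R L_R hR hRL b hbpos hb hbb₀
  set q := Module.finrank ℝ (CondRisk.HistSpace d k) with hq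
  set τ : ℕ → ℝ := fun N => b₀ N ^ (q + 1) with hτ
  set Bad : ℕ → Set Ω := fun N => CondRisk.deviationEvent μ z K ℓ (b N) (τ N) (N - d) ∪
    CondRisk.deviationEvent μ z K (CondRisk.oneLoss k) (b N) (τ N) (N - d) with hBad
  have hBadle : ∀ᶠ N in atTop, ∀ n, n₁ N ≤ n → n ^ 2 ≤ N - d → μ (Bad N) ≤
      2 * (ENNReal.ofReal (1 / (n : ℝ) ^ 4)
        + (n : ENNReal) ^ 2 * CondRisk.betaCoeff μ z ((N - d) / n - d)) := by
    filter_upwards [hbound, hbb₀] with N hN hbN n hn hnN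
    rw [two_mul]
    refine (measure_union_le _ _).trans (add_le_add ?_ ?_)
    · exact hN n hn hnN Ω μ z hz hst H ℓ hℓm hℓ hmeas
        (CondRisk.maxCoveringNumber_le_max_one hcovℓ) (b N) hbN
    · exact hN n hn hnN Ω μ z hz hst PUnit (CondRisk.oneLoss k) (fun _ => measurable_const)
        (fun _ _ => by simp [CondRisk.oneLoss]) (CondRisk.isMeasurableClass_oneLoss k)
        (fun θ hθ n => CondRisk.maxCoveringNumber_oneLoss_le k hθ n (le_max_right _ _)) (b N) hbN
  -- Relative to the kernel mass scale `b ^ q`, the tolerance is at most `b₀`, which tends to zero.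
  have hτle : ∀ᶠ N in atTop, τ N ≤ b₀ N * b N ^ q := by
    filter_upwards [hbb₀] with N hN
    have := (hb₀pos N).le
    change b₀ N ^ (q + 1) ≤ b₀ N * b N ^ q
    rw [pow_succ']
    gcongr
  have hdet : ∀ (X : Set (CondRisk.HistSpace d k)) (c b₁ : ℝ), 0 < c → 0 < b₁ →
      (∀ b, 0 < b → b ≤ b₁ → ∀ x ∈ X,
        b ^ q * c ≤ ∫ y in CondRisk.unitCube d k, K (b⁻¹ • (x - y))) →
      ∀ ε : ℝ, 0 < ε → ∀ᶠ N in atTop, ∀ ω, ω ∉ Bad N → CondRisk.toVec (CondRisk.hist z d N ω) ∈ X →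
        CondRisk.uniformDeviation K ℓ R z (b N) N ω ≤ ENNReal.ofReal ε := by
    intro X c b₁ hc hb₁ hX ε hε
    filter_upwards [CondRisk.eventually_uniformDeviation_le hcomp hz hD₀ hD₁ hK hℓm hℓ hR hRL hbpos
      hb hb₀ hτle hc hb₁ hX hε] with N hN ω hω hωX
    exact hN ω (fun h => hω (Or.inl h)) (fun h => hω (Or.inr h)) hωX
  constructor
  · intro ε hε
    have hBad0 : Tendsto (fun N => μ (Bad N)) atTop (𝓝 0) := by
      have hr := (tendsto_natCast_atTop_atTop (R := ℝ)).comp hn₁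
      have h1 : Tendsto (fun N => 2 * (ENNReal.ofReal (1 / (n₁ N : ℝ) ^ 4)
          + ENNReal.ofReal (1 / ((n₁ N : ℝ) + 1)))) atTop (𝓝 (2 * (ENNReal.ofReal 0
            + ENNReal.ofReal 0))) := by
        refine ENNReal.Tendsto.const_mul ((ENNReal.tendsto_ofReal ?_).add
          (ENNReal.tendsto_ofReal ?_)) (Or.inr (by simp))
        · exact ((tendsto_pow_atTop (n := 4) (by norm_num)).comp hr).const_div_atTop 1
        · exact (tendsto_atTop_add_const_right _ 1 hr).const_div_atTop 1
      simp only [ENNReal.ofReal_zero, add_zero, mul_zero] at h1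
      refine tendsto_of_tendsto_of_tendsto_of_le_of_le' tendsto_const_nhds h1
        (Eventually.of_forall fun _ => zero_le) ?_
      filter_upwards [hBadle, hn₁β] with N hN hNβ
      refine (hN (n₁ N) le_rfl (by omega)).trans ?_
      gcongr
      refine le_trans ?_ hNβ.2
      gcongr
      exact hmix _
    rw [ENNReal.tendsto_nhds_zero]
    intro δ hδ
    -- The volume allowed to the boundary layer, so that the last history falls there with
    -- probability at most `δ / 2`.
    have hη : 0 < δ / 2 / ENNReal.ofReal D₁ :=
      ENNReal.div_pos (ENNReal.half_pos hδ.ne').ne' ENNReal.ofReal_ne_top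
    obtain ⟨t, ht, hvol⟩ := CondRisk.exists_volume_unitCube_diff_innerCube_le d k hη
    obtain ⟨c, b₁, hc, hb₁, hX⟩ := hK.exists_lower_bound_innerCube ht
    filter_upwards [hdet _ c b₁ hc hb₁ hX (ε / 2) (by positivity), eventually_ge_atTop d,
      (ENNReal.tendsto_nhds_zero.1 hBad0) (δ / 2) (ENNReal.half_pos hδ.ne')] with N h1 h2 h3
    have hsub : {ω | ENNReal.ofReal ε ≤ CondRisk.uniformDeviation K ℓ R z (b N) N ω} ⊆
        Bad N ∪ {ω | CondRisk.toVec (CondRisk.hist z d N ω) ∉ CondRisk.innerCube d k t} := by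
      intro ω hω
      by_contra hnot
      rw [Set.mem_union, not_or] at hnot
      have h4 := h1 ω hnot.1 (not_not.1 hnot.2)
      have h5 : ENNReal.ofReal ε ≤ ENNReal.ofReal (ε / 2) := le_trans hω h4
      rw [ENNReal.ofReal_le_ofReal_iff (by positivity)] at h5
      linarith
    calc _ ≤ μ (Bad N) + μ {ω | CondRisk.toVec (CondRisk.hist z d N ω)
          ∉ CondRisk.innerCube d k t} := (measure_mono hsub).trans (measure_union_le _ _)
      _ ≤ δ / 2 + δ / 2 := by
          refine add_le_add h3 ((hcomp.measure_notMem_innerCube_le h2 t).trans ?_)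
          exact (mul_le_mul_right hvol _).trans ENNReal.mul_div_le
      _ = δ := ENNReal.add_halves δ
  · rintro ⟨c₁, c₂, hc₁, hc₂, hexp⟩ hch
    -- A boundary layer of fixed width has no summable probabilities to offer Borel–Cantelli; the
    -- orthant condition makes the lower bound hold on the whole cube, so none is removed.
    obtain ⟨c, b₁, hc, hb₁, hX⟩ := hK.exists_lower_bound_unitCube hch
    have hev : ∀ᶠ N in atTop, μ (Bad N) ≤ ENNReal.ofReal (64 / ((N - d : ℕ) : ℝ) ^ 2) := by
      filter_upwards [hBadle, hn₁β, CondRisk.eventually_sqrt_mixing_bound_le d hc₁ hc₂]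
        with N h1 h2 h3
      -- The threshold was built for all block numbers from `n₁ N` on, and `n₁ N ^ 2 + d ≤ N` admits
      -- the square root.
      have h4 := h1 (Nat.sqrt (N - d)) (Nat.le_sqrt'.2 (by omega)) (Nat.sqrt_le' _)
      refine h4.trans (le_trans ?_ h3)
      gcongr
      exact hexp _
    obtain ⟨N₀, hN₀⟩ := eventually_atTop.1 (hev.and (eventually_gt_atTop d))
    have hsum : ∑' i, μ (Bad (i + N₀)) ≠ ⊤ :=
      ne_top_of_le_ne_top (CondRisk.tsum_ofReal_div_sq_ne_top 64 d (hN₀ N₀ le_rfl).2)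
        (ENNReal.tsum_le_tsum fun i => (hN₀ (i + N₀) (Nat.le_add_left _ _)).1)
    filter_upwards [ae_eventually_notMem hsum] with ω hω
    obtain ⟨i₀, hi₀⟩ := eventually_atTop.1 hω
    have hω' : ∀ᶠ N in atTop, ω ∉ Bad N := by
      filter_upwards [eventually_ge_atTop (i₀ + N₀)] with N hN
      have := hi₀ (N - N₀) (by omega)
      rwa [Nat.sub_add_cancel (by omega)] at this
    refine CondRisk.tendsto_zero_of_forall_eventually_le fun ε hε => ?_
    filter_upwards [hω', hdet _ c b₁ hc hb₁ hX ε hε] with N h1 h2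
    exact h2 ω h1 (CondRisk.toVec_mem_unitCube _)
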